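/- Let $\mathbb{K}=\mathbb{R}$ or $\mathbb{C}$, let $\Theta$ be an unknown function of the ten independent variables $x^1,\dots,x^5,y^1,\dots,y^5$, put $$\omega_{ik}=\Theta_{x^iy^k}-\Theta_{x^ky^i},\qquad i,k\in\{1,\dots,5\},$$ and consider the $5+5$-dimensional system $H^1=\dots=H^5=0$ of five $4+4$-dimensional TED equations, where $$H^1=\omega_{23}\omega_{45}+\omega_{34}\omega_{25}+\omega_{42}\omega_{35},\quad H^2=\omega_{34}\omega_{51}+\omega_{45}\omega_{31}+\omega_{53}\omega_{41},\quad H^3=\omega_{45}\omega_{12}+\omega_{51}\omega_{42}+\omega_{14}\omega_{52},$$ $$H^4=\omega_{51}\omega_{23}+\omega_{12}\omega_{53}+\omega_{25}\omega_{13},\quad H^5=\omega_{12}\omega_{34}+\omega_{23}\omega_{14}+\omega_{31}\omega_{24}.$$ Then the $4+4$-dimensional TED equation $H^5=0$ is multi-dimensionally consistent, that is, the above system, considered at the regular second-order jets (those at which the skew-symmetric matrix $(\omega_{ik})_{i,k\le 5}$ is not zero), is in involution in the sense of Riquier--Janet (Cartan--Kähler) theory: it defines a fibred submanifold $\mathcal{R}_2$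 of the second-order jet space; it is formally integrable, i.e. for every $r\ge 0$ its $(r+1)$-st prolongation $\mathcal{R}_{2+r+1}$ (the jets of order $2+r+1$ over $\mathcal{R}_2$ at which all total derivatives of order at most $r+1$ of $H^1,\dots,H^5$ vanish) projects onto $\mathcal{R}_{2+r}$; and its symbol is involutive, i.e. it passes Cartan's test at every point of $\mathcal{R}_2$, with the same characters at all points. Moreover, only three of the five equations are algebraically independent: at every second-order jet with $\omega_{ik}\neq 0$, all five equations hold if and only if the three equations $H^p=0$, $p\notin\{i,k\}$, hold, and the differentials of these three $H^p$ with respect to the derivatives of $\Theta$ are linearly independent; at every point of $\mathcal{R}_2$ the differentials of $H^1,\dots,H^5$ with respect to the derivatives of $\Theta$ span a space of dimension exactly $3$. -/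

import Mathlib

open scoped Topology

noncomputable section

/-! ### Jets and differential polynomials

One dependent variable `u`, independent variables `x i` with `i : ι`. The coordinates on jet
spaces are `Sum.inl i` (the independent variable `x i`) and `Sum.inr μ` (the derivative `u_μ`
with multi-index `μ`). -/

/-- Points of the jet space of order `q`: a base point together with the values of all the
derivatives `u_μ` of order `|μ| ≤ q`. -/
abbrev Jet (𝕜 : Type*) (ι : Type*) (q : ℕ) : Type _ :=
  (ι → 𝕜) × ({μ : ι →₀ ℕ // μ.degree ≤ q} → 𝕜)

/-- The projection from jets of order `q'` to jets of order `q ≤ q'`. -/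
def Jet.proj {𝕜 : Type*} {ι : Type*} {q q' : ℕ} (h : q ≤ q') (j : Jet 𝕜 ι q') : Jet 𝕜 ι q :=
  (j.1, fun μ => j.2 ⟨μ.1, μ.2.trans h⟩)

/-- Differential polynomials in one unknown: polynomials in the `x i` and the `u_μ`. -/
abbrev DiffPoly (𝕜 : Type*) [CommSemiring 𝕜] (ι : Type*) : Type _ :=
  MvPolynomial (ι ⊕ (ι →₀ ℕ)) 𝕜

/-- The value of a differential polynomial at a jet of order `q`. (It is used only for
polynomials of order at most `q`, in which the `u_μ` with `|μ| > q`, here set to `0`, do not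
occur.) -/
def Jet.eval {𝕜 : Type*} [CommSemiring 𝕜] {ι : Type*} {q : ℕ} (j : Jet 𝕜 ι q)
    (F : DiffPoly 𝕜 ι) : 𝕜 :=
  MvPolynomial.eval
    (Sum.elim j.1 (fun μ => if h : μ.degree ≤ q then j.2 ⟨μ, h⟩ else 0)) F

/-- The total (formal) derivative `D_i = ∂/∂x_i + ∑_μ u_{μ + e_i} ∂/∂u_μ`. -/
def totalDeriv (𝕜 : Type*) [CommSemiring 𝕜] {ι : Type*} [DecidableEq ι] (i : ι) :
    Derivation 𝕜 (DiffPoly 𝕜 ι) (DiffPoly 𝕜 ι) :=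
  MvPolynomial.mkDerivation 𝕜
    (Sum.elim (fun k => if k = i then 1 else 0)
      (fun μ => MvPolynomial.X (Sum.inr (μ + Finsupp.single i 1))))

/-- The iterated total derivative `D_{i₁} ⋯ D_{iₘ} F` along a list of indices. -/
def totalDerivs {𝕜 : Type*} [CommSemiring 𝕜] {ι : Type*} [DecidableEq ι] (l : List ι)
    (F : DiffPoly 𝕜 ι) : DiffPoly 𝕜 ι :=
  l.foldr (fun i G => totalDeriv 𝕜 i G) F

/-! ### Systems of partial differential equations `F a = 0` of order `q`

The system is considered over an open part `U` of the jet space of order `q`, on which it is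
to be regular. -/

/-- The `r`-th prolongation: the jets of order `q + r` lying over `U` at which all equations and
all their total derivatives of order at most `r` vanish. For `r = 0` this is the differential
equation itself, as a subset of the jet space of order `q`. -/
def prolongation {𝕜 : Type*} [CommSemiring 𝕜] {ι : Type*} [DecidableEq ι] {α : Type*} (q : ℕ)
    (F : α → DiffPoly 𝕜 ι) (U : Set (Jet 𝕜 ι q)) (r : ℕ) : Set (Jet 𝕜 ι (q + r)) :=
  {j | j.proj (Nat.le_add_right q r) ∈ U ∧
    ∀ (a : α) (l : List ι), l.length ≤ r → j.eval (totalDerivs l (F a)) = 0}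

/-- The gradient of `F` at a jet of order `q` along the fibre of the jet space over the
base, that is, the partial derivatives with respect to the `u_μ`, `|μ| ≤ q`. -/
def Jet.gradient {𝕜 : Type*} [CommSemiring 𝕜] {ι : Type*} {q : ℕ} (j : Jet 𝕜 ι q)
    (F : DiffPoly 𝕜 ι) : {μ : ι →₀ ℕ // μ.degree ≤ q} → 𝕜 :=
  fun μ => j.eval (MvPolynomial.pderiv (Sum.inr μ.1) F)

/-- The system defines a fibred submanifold of codimension `c` of (the part `U` of) the
jet space: it has points over each point of the base, and around each of its points it is
cut out by `c` of its equations, whose gradients along the fibre are linearly independent. -/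
def IsFibredSubmanifold {𝕜 : Type*} [RCLike 𝕜] {ι : Type*} {α : Type*}
    (q : ℕ) (F : α → DiffPoly 𝕜 ι) (U : Set (Jet 𝕜 ι q)) (c : ℕ) : Prop :=
  (∀ x : ι → 𝕜, ∃ j ∈ U, j.1 = x ∧ ∀ a, j.eval (F a) = 0) ∧
  ∀ j ∈ U, (∀ a, j.eval (F a) = 0) →
    ∃ s : Finset α, s.card = c ∧
      LinearIndependent 𝕜 (fun a : s => j.gradient (F a)) ∧
      ∀ᶠ j' in 𝓝 j, (∀ a ∈ s, Jet.eval j' (F a) = 0) → ∀ a, Jet.eval j' (F a) = 0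

/-- The `r`-th prolongation of the (geometric) symbol at the jet `j` of order `q`: the families
`v_κ`, `|κ| = q + r`, with `∑_{|μ| = q} (∂F_a/∂u_μ)(j) v_{μ + ν} = 0` for all `a` and all
`|ν| = r`. For `r = 0` it is the symbol itself. -/
def symbol {𝕜 : Type*} [Field 𝕜] {ι : Type*} [Fintype ι] [DecidableEq ι] {α : Type*} (q : ℕ)
    (F : α → DiffPoly 𝕜 ι) (j : Jet 𝕜 ι q) (r : ℕ) : Submodule 𝕜 ((ι →₀ ℕ) → 𝕜) where
  carrier := {v | (∀ κ, κ.degree ≠ q + r → v κ = 0) ∧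
    ∀ (a : α) (ν : ι →₀ ℕ), ν.degree = r →
      ∑ μ ∈ Finset.univ.finsuppAntidiag q,
        j.eval (MvPolynomial.pderiv (Sum.inr μ) (F a)) * v (μ + ν) = 0}
  add_mem' := by
    rintro v w ⟨hv, hv'⟩ ⟨hw, hw'⟩
    refine ⟨fun κ h => by simp [hv κ h, hw κ h], fun a ν h => ?_⟩
    simp only [Pi.add_apply, mul_add, Finset.sum_add_distrib, hv' a ν h, hw' a ν h, add_zero]
  zero_mem' := by simp
  smul_mem' := by
    rintro t v ⟨hv, hv'⟩
    refine ⟨fun κ h => by simp [hv κ h], fun a ν h => ?_⟩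
    have := congrArg (t * ·) (hv' a ν h)
    simp only [Finset.mul_sum, mul_zero] at this
    rw [← this]
    exact Finset.sum_congr rfl fun μ _ => by simp only [Pi.smul_apply, smul_eq_mul]; ring

/-- The part of a space of families `v_κ` that is annihilated by contraction with the first `k`
vectors of a basis `b` of `ι → 𝕜`; the contraction of `v` with a vector `w` is the
family `ν ↦ ∑_i w_i v_{ν + e_i}`. -/
def annihilatedPart {𝕜 : Type*} [Field 𝕜] {ι : Type*} [Fintype ι]
    (N : Submodule 𝕜 ((ι →₀ ℕ) → 𝕜)) (b : Module.Basis (Fin (Fintype.card ι)) 𝕜 (ι → 𝕜))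
    (k : ℕ) : Submodule 𝕜 ((ι →₀ ℕ) → 𝕜) where
  carrier := {v | v ∈ N ∧ ∀ m : Fin (Fintype.card ι), (m : ℕ) < k → ∀ ν : ι →₀ ℕ,
    ∑ i, b m i * v (ν + Finsupp.single i 1) = 0}
  add_mem' := by
    rintro v w ⟨hv, hv'⟩ ⟨hw, hw'⟩
    refine ⟨N.add_mem hv hw, fun m h ν => ?_⟩
    simp only [Pi.add_apply, mul_add, Finset.sum_add_distrib, hv' m h ν, hw' m h ν, add_zero]
  zero_mem' := ⟨N.zero_mem, by simp⟩
  smul_mem' := by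
    rintro t v ⟨hv, hv'⟩
    refine ⟨N.smul_mem t hv, fun m h ν => ?_⟩
    have := congrArg (t * ·) (hv' m h ν)
    simp only [Finset.mul_sum, mul_zero] at this
    rw [← this]
    exact Finset.sum_congr rfl fun i _ => by simp only [Pi.smul_apply, smul_eq_mul]; ring

/-- A system of order `q` is *in involution* over `U` if it is a regular differential equation
that is formally integrable and whose symbol is involutive. -/
structure IsInInvolution {𝕜 : Type*} [RCLike 𝕜] {ι : Type*} [Fintype ι] [DecidableEq ι]
    {α : Type*} (q : ℕ) (F : α → DiffPoly 𝕜 ι) (U : Set (Jet 𝕜 ι q)) : Prop where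
  /-- All equations are of order at most `q`. -/
  order_le : ∀ (a : α) (μ : ι →₀ ℕ), Sum.inr μ ∈ (F a).vars → μ.degree ≤ q
  /-- The domain is open in the jet space. -/
  isOpen : IsOpen U
  /-- The system defines a fibred submanifold of the jet space. -/
  regular : ∃ c, IsFibredSubmanifold q F U c
  /-- Formal integrability: each prolongation projects onto the preceding one, so that no
  prolongation produces a new equation of lower order. -/
  formallyIntegrable : ∀ (r : ℕ), ∀ j ∈ prolongation q F U r,
    ∃ j' ∈ prolongation q F U (r + 1), Jet.proj (by omega) j' = j
  /-- The symbol is involutive (Cartan's test), with the same characters at all points. -/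
  symbol_involutive : ∃ d : Fin (Fintype.card ι) → ℕ,
    ∀ j ∈ U, (∀ a, j.eval (F a) = 0) →
      ∃ b : Module.Basis (Fin (Fintype.card ι)) 𝕜 (ι → 𝕜),
        (∀ k : Fin (Fintype.card ι),
          Module.finrank 𝕜 (annihilatedPart (symbol q F j 0) b k) = d k) ∧
        Module.finrank 𝕜 (symbol q F j 1) = ∑ k, d k

/-! ### The TED system

The independent variables are `x^{i+1}`, indexed by `Sum.inl i`, and `y^{i+1}`, indexed by
`Sum.inr i`, for `i : Fin 5`; the unknown is `Θ`. -/

/-- `ω_{ik} = Θ_{x^i y^k} - Θ_{x^k y^i}`. -/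
def tedOmega (𝕜 : Type*) [CommRing 𝕜] (i k : Fin 5) : DiffPoly 𝕜 (Fin 5 ⊕ Fin 5) :=
  MvPolynomial.X (Sum.inr (Finsupp.single (Sum.inl i) 1 + Finsupp.single (Sum.inr k) 1)) -
    MvPolynomial.X (Sum.inr (Finsupp.single (Sum.inl k) 1 + Finsupp.single (Sum.inr i) 1))

/-- The left-hand side of the `4+4`-dimensional TED equation in the variables
with indices `a, b, c, d`. -/
def tedPfaffian (𝕜 : Type*) [CommRing 𝕜] (a b c d : Fin 5) : DiffPoly 𝕜 (Fin 5 ⊕ Fin 5) :=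
  tedOmega 𝕜 a b * tedOmega 𝕜 c d + tedOmega 𝕜 b c * tedOmega 𝕜 a d +
    tedOmega 𝕜 c a * tedOmega 𝕜 b d

/-- The five left-hand sides `H^1, …, H^5`; `tedH 𝕜 p` is `H^{p+1}`, in which the variables
with index `p` do not occur. -/
def tedH (𝕜 : Type*) [CommRing 𝕜] : Fin 5 → DiffPoly 𝕜 (Fin 5 ⊕ Fin 5) :=
  ![tedPfaffian 𝕜 1 2 3 4, tedPfaffian 𝕜 2 3 4 0, tedPfaffian 𝕜 3 4 0 1,
    tedPfaffian 𝕜 4 0 1 2, tedPfaffian 𝕜 0 1 2 3]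

/-- The second-order jets at which the skew-symmetric matrix `ω` does not vanish. -/
def tedDomain (𝕜 : Type*) [CommRing 𝕜] : Set (Jet 𝕜 (Fin 5 ⊕ Fin 5) 2) :=
  {j | ∃ i k, j.eval (tedOmega 𝕜 i k) ≠ 0}

end

/-!
The arrays `ω_{ik}` are the components of the two-form `ω = d_x d_y Θ`, where `d_x` and `d_y` are
the exterior differentials built from the `∂/∂xⁱ` and from the `∂/∂yⁱ`, with a common basis of
one-forms. The five equations say that `ω ∧ ω = 0`, that is, that the skew matrix `ω` has rank at
most two. The linear relations `∑ₖ ω_{ik} Hᵏ = 0` (`sum_mul_pfH`) and their differentials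
(`sum_smul_polarH`) show that three of the equations imply the others wherever `ω ≠ 0`, and give
the statements on the gradients.

*The symbol.* In a basis adapted to the decomposable form `ω` the linearized equations are the
maximal minors of the `2 × 3` matrix with the rows `(ξ₂, ξ₃, ξ₄)` and `(η₂, η₃, η₄)`, where `ξ`,
`η` are the symbols of the derivations (`polarH_eq_minor`). The ideal of these minors governs
everything else.

*Formal integrability* (`exists_prolongation_extension`). The derivatives of order `r + 3` enter
the total derivatives of order `r + 1` linearly, through the symbol; so the task is to solve an
inhomogeneous linear system. Identifying families `v_κ` with linear functionals on the polynomial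
ring in `ξ, η`, one looks for a functional with prescribed values on the multiples of the symbols
of the equations, and it exists as soon as the prescription respects the syzygies. By the
Hilbert–Burch theorem for the `2 × 3` matrix (`MvPolynomial.exists_of_sum_mul_minor_eq_zero`)
these are generated by the two rows of the matrix. The conditions that they impose hold because of
the identities `d_x (ω ∧ ω) = 0` and `d_y (ω ∧ ω) = 0` (`sum_totalDeriv_inl_tedH`,
`sum_totalDeriv_inr_tedH`), and those imposed by the relations `∑ₖ ω_{ik} Hᵏ = 0` hold because the
equations hold in lower order.

*Cartan's test* (`cartan_test_ted`). In suitable coordinates `X₀, …, X₉` the minors have the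
leading terms `X₈²`, `X₈X₉`, `X₉²`, and this remains so after setting the first `k` coordinates to
zero. Hence all the dimensions in question are numbers of monomials containing at most one of
`X₈`, `X₉`, to the first power (`finrank_dualPart_normalIdeal`). Splitting off the first variable
of such a monomial of degree three gives the equality in Cartan's test
(`card_standardExponents_three`).
-/

noncomputable section

/-! ### Pfaffians of skew-symmetric `5 × 5` matrices and their polarization -/

section Pfaffian

variable {R M : Type*} [CommRing R] [AddCommGroup M] [Module R M]

/-- Skew-symmetry of a square array, with vanishing diagonal (so that it is the right notion in
every characteristic). -/
structure IsSkew {A : Type*} [AddCommGroup A] (Z : Fin 5 → Fin 5 → A) : Prop where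
  diag : ∀ i, Z i i = 0
  swap : ∀ i k, Z i k = -Z k i

/-- The Pfaffian of the `4 × 4` minor of `w` with rows and columns `a, b, c, d`. -/
def pf (w : Fin 5 → Fin 5 → R) (a b c d : Fin 5) : R :=
  w a b * w c d + w b c * w a d + w c a * w b d

/-- The five sub-Pfaffians of `w`, with the signs and the numbering of `tedH`. -/
def pfH (w : Fin 5 → Fin 5 → R) : Fin 5 → R :=
  ![pf w 1 2 3 4, pf w 2 3 4 0, pf w 3 4 0 1, pf w 4 0 1 2, pf w 0 1 2 3]

/-- The differential of `pf` at `w`, applied to the direction `Z`; the entries of `Z` may lie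
in any module. -/
def pfPolar (w : Fin 5 → Fin 5 → R) (Z : Fin 5 → Fin 5 → M) (a b c d : Fin 5) : M :=
  (w a b • Z c d + w c d • Z a b) + (w b c • Z a d + w a d • Z b c) +
    (w c a • Z b d + w b d • Z c a)

/-- The differential of `pfH` at `w`, applied to the direction `Z`. -/
def polarH (w : Fin 5 → Fin 5 → R) (Z : Fin 5 → Fin 5 → M) : Fin 5 → M :=
  ![pfPolar w Z 1 2 3 4, pfPolar w Z 2 3 4 0, pfPolar w Z 3 4 0 1, pfPolar w Z 4 0 1 2,
    pfPolar w Z 0 1 2 3]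

theorem map_polarH {N : Type*} [AddCommGroup N] [Module R N] (φ : M →ₗ[R] N)
    (w : Fin 5 → Fin 5 → R) (Z : Fin 5 → Fin 5 → M) (p : Fin 5) :
    φ (polarH w Z p) = polarH w (fun i k => φ (Z i k)) p := by
  fin_cases p <;> simp [polarH, pfPolar]

theorem ringHom_pfH {R' : Type*} [CommRing R'] (φ : R →+* R')
    (w : Fin 5 → Fin 5 → R) (p : Fin 5) :
    φ (pfH w p) = pfH (fun i k => φ (w i k)) p := by
  fin_cases p <;> simp [pfH, pf]

theorem ringHom_polarH {R' : Type*} [CommRing R'] (φ : R →+* R')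
    (w : Fin 5 → Fin 5 → R) (Z : Fin 5 → Fin 5 → R) (p : Fin 5) :
    φ (polarH w Z p) = polarH (fun i k => φ (w i k)) (fun i k => φ (Z i k)) p := by
  fin_cases p <;> simp [polarH, pfPolar]

theorem derivation_pfH {K : Type*} [CommRing K] [Algebra K R] (D : Derivation K R R)
    (w : Fin 5 → Fin 5 → R) (p : Fin 5) :
    D (pfH w p) = polarH w (fun i k => D (w i k)) p := by
  fin_cases p <;> simp [pfH, pf, polarH, pfPolar, Derivation.leibniz]

/-- The algebraic relations between the sub-Pfaffians: the skew matrix annihilates the vector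
of its signed `4 × 4` sub-Pfaffians. -/
theorem sum_mul_pfH {w : Fin 5 → Fin 5 → R} (hw : IsSkew w) (i : Fin 5) :
    ∑ k, w i k * pfH w k = 0 := by
  have h := hw.swap
  have hd := hw.diag
  simp only [Fin.sum_univ_five, pfH, pf, Matrix.cons_val]
  fin_cases i <;>
  simp only [hd, h 1 0, h 2 0, h 3 0, h 4 0, h 2 1, h 3 1, h 4 1, h 3 2, h 4 2, h 4 3,
    Fin.zero_eta, Fin.mk_one, Fin.reduceFinMk] <;> ring

/-- The differential of `sum_mul_pfH`. -/
theorem sum_smul_polarH {w : Fin 5 → Fin 5 → R} (hw : IsSkew w) {Z : Fin 5 → Fin 5 → M}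
    (hZ : IsSkew Z) (i : Fin 5) :
    ∑ k, w i k • polarH w Z k = -∑ k, pfH w k • Z i k := by
  have h := hw.swap
  have hd := hw.diag
  have h' := hZ.swap
  have hd' := hZ.diag
  simp only [Fin.sum_univ_five, pfH, pf, polarH, pfPolar, Matrix.cons_val]
  fin_cases i <;>
  simp only [hd, h 1 0, h 2 0, h 3 0, h 4 0, h 2 1, h 3 1, h 4 1, h 3 2, h 4 2, h 4 3,
    hd', h' 1 0, h' 2 0, h' 3 0, h' 4 0, h' 2 1, h' 3 1, h' 4 1, h' 3 2, h' 4 2, h' 4 3,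
    Fin.zero_eta, Fin.mk_one, Fin.reduceFinMk] <;> module

/-- If `T p` are the derivatives of a closed two-form in the direction `p`, then the sum of the
corresponding derivatives of the sub-Pfaffians of `w` vanishes: this is the component of `w ∧ d w` in
top degree. -/
theorem sum_polarH_of_closed {w : Fin 5 → Fin 5 → R} (hw : IsSkew w)
    {T : Fin 5 → Fin 5 → Fin 5 → R} (hT : ∀ p, IsSkew (T p))
    (hc : ∀ p i k, T p i k + T i k p + T k p i = 0) :
    ∑ p, polarH w (T p) p = 0 := by
  have h := hw.swap
  have h' := fun p => (hT p).swap
  simp only [Fin.sum_univ_five, polarH, pfPolar, Matrix.cons_val, smul_eq_mul]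
  simp only [h 2 0, h 3 0, h 4 0, h 3 1, h 4 1, h 4 2, h' _ 2 0, h' _ 3 0, h' _ 4 0, h' _ 3 1,
    h' _ 4 1, h' _ 4 2]
  have c (a b c : Fin 5) : T c a b = - T a b c - T b c a := by
    linear_combination hc c a b
  rw [c 0 1 2, c 0 1 3, c 0 1 4, c 0 2 3, c 0 2 4, c 0 3 4, c 1 2 3, c 1 2 4, c 1 3 4, c 2 3 4]
  simp only [h' _ 2 0, h' _ 3 0, h' _ 4 0, h' _ 3 1, h' _ 4 1, h' _ 4 2]
  ring

theorem IsSkew.comp {Z : Fin 5 → Fin 5 → M} (hZ : IsSkew Z) (σ : Fin 5 → Fin 5) :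
    IsSkew (fun i k => Z (σ i) (σ k)) :=
  ⟨fun _ => hZ.diag _, fun _ _ => hZ.swap _ _⟩

/-- A renumbering of the indices permutes the sub-Pfaffians, up to its sign. -/
theorem polarH_comp_perm (σ : Equiv.Perm (Fin 5)) :
    ∀ {w : Fin 5 → Fin 5 → R} (_ : IsSkew w) {Z : Fin 5 → Fin 5 → M} (_ : IsSkew Z)
      (p : Fin 5), polarH (fun i k => w (σ i) (σ k)) (fun i k => Z (σ i) (σ k)) p =
        (Equiv.Perm.sign σ : ℤ) • polarH w Z (σ p) := by
  have hmem : σ ∈ Submonoid.closure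
      (Set.range fun i : Fin 4 => Equiv.swap i.castSucc i.succ) := by
    rw [Equiv.Perm.mclosure_swap_castSucc_succ]; trivial
  induction hmem using Submonoid.closure_induction with
  | one => intro w hw Z hZ p; simp
  | mul σ τ _ _ hσ hτ =>
    intro w hw Z hZ p
    have := hτ (hw.comp σ) (hZ.comp σ) p
    simp only [Equiv.Perm.mul_apply]
    rw [this, hσ hw hZ, smul_smul, Equiv.Perm.sign_mul, mul_comm]
    simp
  | mem x hx =>
    obtain ⟨a, rfl⟩ := hx
    intro w hw Z hZ p
    have h := hw.swap
    have h' := hZ.swap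
    have hs : Equiv.Perm.sign (Equiv.swap a.castSucc a.succ) = -1 :=
      Equiv.Perm.sign_swap a.castSucc_lt_succ.ne
    have e0 : ∀ i : Fin 5, (Equiv.swap (0 : Fin 5) 1) i = ![1, 0, 2, 3, 4] i := by decide
    have e1 : ∀ i : Fin 5, (Equiv.swap (1 : Fin 5) 2) i = ![0, 2, 1, 3, 4] i := by decide
    have e2 : ∀ i : Fin 5, (Equiv.swap (2 : Fin 5) 3) i = ![0, 1, 3, 2, 4] i := by decide
    have e3 : ∀ i : Fin 5, (Equiv.swap (3 : Fin 5) 4) i = ![0, 1, 2, 4, 3] i := by decide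
    rw [hs]
    fin_cases a <;> fin_cases p <;>
    simp [polarH, pfPolar, e0, e1, e2, e3] <;>
    simp only [h 1 0, h 2 0, h 3 0, h 4 0, h 2 1, h 3 1, h 4 1, h 3 2, h 4 2, h 4 3,
    h' 1 0, h' 2 0, h' 3 0, h' 4 0, h' 2 1, h' 3 1, h' 4 1, h' 3 2, h' 4 2, h' 4 3] <;> module

/-- For `w` decomposable with `w 0 1 ≠ 0` and `ξ` the standard basis, `shear w ξ q`, `q = 2, 3, 4`,
is a basis of the kernel of `w`, normalized to be congruent to `ξ q` modulo `ξ 0, ξ 1`. -/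
def shear {K A : Type*} [Field K] [AddCommGroup A] [Module K A] (w : Fin 5 → Fin 5 → K)
    (ξ : Fin 5 → A) (q : Fin 5) : A :=
  ξ q + ((w 0 1)⁻¹ * w 1 q) • ξ 0 - ((w 0 1)⁻¹ * w 0 q) • ξ 1

/-- The linearization of a sub-Pfaffian containing the indices `0, 1` at a decomposable `w`. -/
theorem pfPolar_eq_of_pf_eq_zero {K S : Type*} [Field K] [CommRing S] [Algebra K S]
    {w : Fin 5 → Fin 5 → K} (hw : IsSkew w) (h01 : w 0 1 ≠ 0) {q s : Fin 5}
    (h : pf w 0 1 q s = 0) (ξ η : Fin 5 → S) :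
    pfPolar w (fun i k => ξ i * η k - ξ k * η i) 0 1 q s =
      w 0 1 • (shear w ξ q * shear w η s - shear w ξ s * shear w η q) := by
  have hqs : w q s = (w 0 1)⁻¹ * (w 0 q * w 1 s - w 0 s * w 1 q) := by
    rw [pf, hw.swap q 0] at h
    field_simp
    linear_combination h
  have hct : algebraMap K S (w 0 1) * algebraMap K S (w 0 1)⁻¹ = 1 := by
    rw [← map_mul, mul_inv_cancel₀ h01, map_one]
  simp only [pfPolar, shear, hqs, hw.swap q 0, Algebra.smul_def, map_mul, map_sub, map_neg]
  generalize algebraMap K S (w 0 1) = c at *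
  generalize algebraMap K S (w 0 1)⁻¹ = t at *
  generalize algebraMap K S (w 0 q) = a
  generalize algebraMap K S (w 1 q) = b
  generalize algebraMap K S (w 0 s) = d
  generalize algebraMap K S (w 1 s) = e
  linear_combination (-(t * (a * e - d * b) * (ξ 0 * η 1 - ξ 1 * η 0)
    + (b * (ξ 0 * η s - ξ s * η 0) + d * (ξ 1 * η q - ξ q * η 1))
    + (-a * (ξ 1 * η s - ξ s * η 1) + e * (ξ q * η 0 - ξ 0 * η q)))) * hct

/-- At a decomposable `w` with `w 0 1 ≠ 0` the linearizations of the three sub-Pfaffians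
containing the indices `0, 1` are the maximal minors of a `2 × 3` matrix. -/
theorem polarH_eq_minor {K S : Type*} [Field K] [CommRing S] [Algebra K S]
    {w : Fin 5 → Fin 5 → K} (hw : IsSkew w) (h01 : w 0 1 ≠ 0) (h : ∀ p, pfH w p = 0)
    (ξ η : Fin 5 → S) :
    polarH w (fun i k => ξ i * η k - ξ k * η i) 2 =
      w 0 1 • (shear w ξ 3 * shear w η 4 - shear w ξ 4 * shear w η 3) ∧
    polarH w (fun i k => ξ i * η k - ξ k * η i) 3 =
      w 0 1 • (shear w ξ 4 * shear w η 2 - shear w ξ 2 * shear w η 4) ∧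
    polarH w (fun i k => ξ i * η k - ξ k * η i) 4 =
      w 0 1 • (shear w ξ 2 * shear w η 3 - shear w ξ 3 * shear w η 2) := by
  have h2 : pf w 0 1 3 4 = 0 := by
    rw [← h 2]; simp only [pf, pfH, Matrix.cons_val]
    rw [hw.swap 1 3, hw.swap 4 0, hw.swap 3 0, hw.swap 4 1]; ring
  have h3 : pf w 0 1 4 2 = 0 := by
    rw [← h 3]; simp only [pf, pfH, Matrix.cons_val]; ring
  refine ⟨?_, ?_, ?_⟩
  · rw [← pfPolar_eq_of_pf_eq_zero hw h01 h2 ξ η]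
    simp only [polarH, pfPolar, Matrix.cons_val]
    rw [hw.swap 1 3, hw.swap 4 0, hw.swap 3 0, hw.swap 4 1]
    module
  · rw [← pfPolar_eq_of_pf_eq_zero hw h01 h3 ξ η]
    simp only [polarH, pfPolar, Matrix.cons_val]
    module
  · rw [← pfPolar_eq_of_pf_eq_zero hw h01 (h 4) ξ η]
    rfl

end Pfaffian

/-! ### The TED equations at a jet -/

section TED

variable {𝕜 : Type*}

/-- The multi-index of the derivative `∂² / ∂xⁱ∂yᵏ`. -/
def xy (i k : Fin 5) : (Fin 5 ⊕ Fin 5) →₀ ℕ :=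
  Finsupp.single (Sum.inl i) 1 + Finsupp.single (Sum.inr k) 1

theorem degree_xy (i k : Fin 5) : (xy i k).degree = 2 := by
  simp [xy]

theorem xy_inj {i k a b : Fin 5} : xy i k = xy a b ↔ i = a ∧ k = b := by
  refine ⟨fun h => ?_, by rintro ⟨rfl, rfl⟩; rfl⟩
  have h1 := DFunLike.congr_fun h (Sum.inl a)
  have h2 := DFunLike.congr_fun h (Sum.inr b)
  simp [xy, Finsupp.single_apply] at h1 h2
  exact ⟨h1, h2⟩

/-- The elementary skew-symmetric matrix `e_a ∧ e_b`. -/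
def wedgeE (R : Type*) [CommRing R] (a b i k : Fin 5) : R :=
  (if i = a ∧ k = b then 1 else 0) - (if k = a ∧ i = b then 1 else 0)

theorem isSkew_wedgeE (R : Type*) [CommRing R] (a b : Fin 5) : IsSkew (wedgeE R a b) :=
  ⟨fun i => by simp [wedgeE], fun i k => by simp [wedgeE]⟩

section CommRing

variable [CommRing 𝕜]

theorem tedOmega_eq (i k : Fin 5) :
    tedOmega 𝕜 i k = MvPolynomial.X (Sum.inr (xy i k)) - MvPolynomial.X (Sum.inr (xy k i)) := rfl

theorem tedH_eq : tedH 𝕜 = pfH (tedOmega 𝕜) := rfl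

theorem isSkew_tedOmega : IsSkew (tedOmega 𝕜) :=
  ⟨fun i => by simp [tedOmega_eq], fun i k => by simp [tedOmega_eq]⟩

/-- The coordinates of a jet of order `q`, completed by zeros in higher order. -/
def Jet.coord {ι : Type*} {q : ℕ} (j : Jet 𝕜 ι q) : ι ⊕ (ι →₀ ℕ) → 𝕜 :=
  Sum.elim j.1 (fun μ => if h : μ.degree ≤ q then j.2 ⟨μ, h⟩ else 0)

theorem Jet.eval_eq {ι : Type*} {q : ℕ} (j : Jet 𝕜 ι q) (F : DiffPoly 𝕜 ι) :
    j.eval F = MvPolynomial.eval j.coord F := rfl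

/-- The matrix `ω` at a jet. -/
def omegaAt {q : ℕ} (j : Jet 𝕜 (Fin 5 ⊕ Fin 5) q) (i k : Fin 5) : 𝕜 := j.eval (tedOmega 𝕜 i k)

theorem isSkew_omegaAt {q : ℕ} (j : Jet 𝕜 (Fin 5 ⊕ Fin 5) q) : IsSkew (omegaAt j) :=
  ⟨fun i => by simp [omegaAt, isSkew_tedOmega.diag, Jet.eval_eq],
    fun i k => by simp [omegaAt, isSkew_tedOmega.swap i k, Jet.eval_eq]⟩

theorem eval_tedH {q : ℕ} (j : Jet 𝕜 (Fin 5 ⊕ Fin 5) q) (p : Fin 5) :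
    j.eval (tedH 𝕜 p) = pfH (omegaAt j) p := by
  rw [tedH_eq, Jet.eval_eq, ringHom_pfH]; rfl

theorem eval_pderiv_tedH {q : ℕ} (j : Jet 𝕜 (Fin 5 ⊕ Fin 5) q) (p : Fin 5)
    (μ : (Fin 5 ⊕ Fin 5) →₀ ℕ) :
    j.eval (MvPolynomial.pderiv (Sum.inr μ) (tedH 𝕜 p)) =
      polarH (omegaAt j) (fun i k =>
        (if xy i k = μ then 1 else 0) - (if xy k i = μ then 1 else 0)) p := by
  classical
  rw [tedH_eq, derivation_pfH, Jet.eval_eq, ringHom_polarH]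
  congr 1
  funext i k
  simp only [tedOmega_eq, map_sub, MvPolynomial.pderiv_X, Pi.single_apply, Sum.inr.injEq]
  split_ifs <;> simp

theorem gradient_tedH (j : Jet 𝕜 (Fin 5 ⊕ Fin 5) 2) (p : Fin 5) :
    j.gradient (tedH 𝕜 p) = polarH (omegaAt j) (fun i k μ =>
        (if xy i k = μ.1 then 1 else 0) - (if xy k i = μ.1 then 1 else 0)) p := by
  funext μ
  rw [Jet.gradient, eval_pderiv_tedH]
  fin_cases p <;> rfl

theorem gradient_tedH_apply_xy (j : Jet 𝕜 (Fin 5 ⊕ Fin 5) 2) (p a b : Fin 5) :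
    j.gradient (tedH 𝕜 p) ⟨xy a b, (degree_xy a b).le⟩ = polarH (omegaAt j) (wedgeE 𝕜 a b) p := by
  rw [Jet.gradient, eval_pderiv_tedH]
  simp only [xy_inj]
  rfl

end CommRing

section Field

variable [Field 𝕜]

theorem exists_perm_of_ne {i k : Fin 5} (h : i ≠ k) :
    ∃ σ : Equiv.Perm (Fin 5), σ 0 = i ∧ σ 1 = k := by
  refine ⟨Equiv.swap (Equiv.swap 0 i 1) k * Equiv.swap 0 i, ?_, ?_⟩
  · rw [Equiv.Perm.mul_apply, Equiv.swap_apply_left]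
    refine Equiv.swap_apply_of_ne_of_ne (fun h' => ?_) h
    have : Equiv.swap 0 i 0 = Equiv.swap 0 i 1 := by rw [Equiv.swap_apply_left]; exact h'
    exact absurd ((Equiv.swap 0 i).injective this) (by decide)
  · rw [Equiv.Perm.mul_apply, Equiv.swap_apply_left]

/-- If `w i k ≠ 0`, then a suitable elementary direction changes just one of the three
sub-Pfaffians containing the indices `i, k`, to first order. -/
theorem exists_wedgeE_polarH {w : Fin 5 → Fin 5 → 𝕜} (hw : IsSkew w) {i k p : Fin 5}
    (h : w i k ≠ 0) (hi : p ≠ i) (hk : p ≠ k) :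
    ∃ a b, polarH w (wedgeE 𝕜 a b) p ≠ 0 ∧
      ∀ p', p' ≠ i → p' ≠ k → p' ≠ p → polarH w (wedgeE 𝕜 a b) p' = 0 := by
  have hik : i ≠ k := by rintro rfl; exact h (hw.diag i)
  obtain ⟨σ, rfl, rfl⟩ := exists_perm_of_ne hik
  have key : ∀ a b p, polarH w (wedgeE 𝕜 (σ a) (σ b)) (σ p) =
      ((Equiv.Perm.sign σ : ℤ) : 𝕜) * polarH (fun i k => w (σ i) (σ k)) (wedgeE 𝕜 a b) p := by
    intro a b p
    have h1 := polarH_comp_perm σ hw (isSkew_wedgeE 𝕜 (σ a) (σ b)) p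
    have h2 : (fun i k => wedgeE 𝕜 (σ a) (σ b) (σ i) (σ k)) = wedgeE 𝕜 a b := by
      funext i k; simp [wedgeE]
    rw [h2] at h1
    rw [h1, zsmul_eq_mul, ← mul_assoc, ← Int.cast_mul, Int.units_coe_mul_self]
    simp
  have hs : ((Equiv.Perm.sign σ : ℤ) : 𝕜) ≠ 0 := by
    rcases Int.units_eq_one_or (Equiv.Perm.sign σ) with h | h <;> simp [h]
  obtain ⟨p, rfl⟩ := σ.surjective p
  refine ⟨σ (![0, 0, 3, 4, 2] p), σ (![0, 0, 4, 2, 3] p), ?_, fun p' => ?_⟩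
  · rw [key]
    refine mul_ne_zero hs ?_
    clear key hs
    fin_cases p <;> simp_all [polarH, pfPolar, wedgeE]
  · obtain ⟨p', rfl⟩ := σ.surjective p'
    rw [key]
    simp only [σ.injective.ne_iff] at *
    intro h1 h2 h3
    clear key hs
    fin_cases p <;> fin_cases p' <;> simp_all [polarH, pfPolar, wedgeE]

theorem pfH_eq_zero_iff {w : Fin 5 → Fin 5 → 𝕜} (hw : IsSkew w) {i k : Fin 5} (h : w i k ≠ 0) :
    (∀ p, pfH w p = 0) ↔ ∀ p, p ≠ i → p ≠ k → pfH w p = 0 := by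
  refine ⟨fun h p _ _ => h p, fun H => ?_⟩
  have aux : ∀ i k, w i k ≠ 0 → (∀ p, p ≠ i → p ≠ k → pfH w p = 0) → pfH w k = 0 := by
    intro i k h H
    have h1 := sum_mul_pfH hw i
    rw [Finset.sum_eq_single k] at h1
    · exact (mul_eq_zero.1 h1).resolve_left h
    · intro p _ hp
      by_cases hi : p = i
      · rw [hi, hw.diag, zero_mul]
      · rw [H p hi hp, mul_zero]
    · simp
  intro p
  by_cases hk : p = k
  · subst hk; exact aux i p h H
  by_cases hi : p = i
  · subst hi
    exact aux k p (by rw [hw.swap]; simpa using h) (fun q h1 h2 => H q h2 h1)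
  · exact H p hi hk

theorem linearIndependent_gradient_tedH {j : Jet 𝕜 (Fin 5 ⊕ Fin 5) 2} {i k : Fin 5}
    (h : omegaAt j i k ≠ 0) :
    LinearIndependent 𝕜
      (fun p : {p : Fin 5 // p ≠ i ∧ p ≠ k} => j.gradient (tedH 𝕜 p)) := by
  rw [Fintype.linearIndependent_iff]
  intro c hc p
  obtain ⟨a, b, h1, h2⟩ := exists_wedgeE_polarH (isSkew_omegaAt j) h p.2.1 p.2.2
  have h3 := congrFun hc ⟨xy a b, (degree_xy a b).le⟩
  simp only [Finset.sum_apply, Pi.smul_apply, gradient_tedH_apply_xy, smul_eq_mul,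
    Pi.zero_apply] at h3
  rw [Finset.sum_eq_single p] at h3
  · exact (mul_eq_zero.1 h3).resolve_right h1
  · intro q _ hq
    rw [h2 q q.2.1 q.2.2 (fun h => hq (Subtype.ext h)), mul_zero]
  · simp

/-- Where the Pfaffians vanish and `w i k ≠ 0`, the rows `i` and `k` of the relations
`sum_smul_polarH` express the `i`-th and the `k`-th of the five differentials by the others. -/
theorem polarH_mem_span {M : Type*} [AddCommGroup M] [Module 𝕜 M] {w : Fin 5 → Fin 5 → 𝕜}
    (hw : IsSkew w) {Z : Fin 5 → Fin 5 → M} (hZ : IsSkew Z) {i k : Fin 5} (h : w i k ≠ 0)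
    (H : ∀ p, pfH w p = 0) (p : Fin 5) :
    polarH w Z p ∈ Submodule.span 𝕜
      (Set.range fun p : {p : Fin 5 // p ≠ i ∧ p ≠ k} => polarH w Z p) := by
  set V := Submodule.span 𝕜 (Set.range fun p : {p : Fin 5 // p ≠ i ∧ p ≠ k} => polarH w Z p)
  have hV : ∀ p, p ≠ i → p ≠ k → polarH w Z p ∈ V := fun p hi hk =>
    Submodule.subset_span ⟨⟨p, hi, hk⟩, rfl⟩
  have aux : ∀ i k, w i k ≠ 0 → (∀ p, p ≠ i → p ≠ k → polarH w Z p ∈ V) →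
      polarH w Z k ∈ V := by
    intro i k h hV
    have h1 := sum_smul_polarH hw hZ i
    simp only [H, zero_smul, Finset.sum_const_zero, neg_zero] at h1
    rw [← Finset.add_sum_erase _ _ (Finset.mem_univ k)] at h1
    rw [← Submodule.smul_mem_iff V h, eq_neg_of_add_eq_zero_left h1]
    refine V.neg_mem (V.sum_mem fun p hp => ?_)
    by_cases hi : p = i
    · rw [hi, hw.diag, zero_smul]; exact V.zero_mem
    · exact V.smul_mem _ (hV p hi (Finset.ne_of_mem_erase hp))
  by_cases hk : p = k
  · subst hk; exact aux i p h hV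
  by_cases hi : p = i
  · subst hi
    exact aux k p (by rw [hw.swap]; simpa using h) (fun q h1 h2 => hV q h2 h1)
  · exact hV p hi hk

theorem finrank_span_gradient_tedH {j : Jet 𝕜 (Fin 5 ⊕ Fin 5) 2} {i k : Fin 5}
    (h : omegaAt j i k ≠ 0) (H : ∀ p, j.eval (tedH 𝕜 p) = 0) :
    Module.finrank 𝕜
      (Submodule.span 𝕜 (Set.range (fun p : Fin 5 => j.gradient (tedH 𝕜 p)))) = 3 := by
  have hik : i ≠ k := by rintro rfl; exact h ((isSkew_omegaAt j).diag i)
  have hspan : Submodule.span 𝕜 (Set.range (fun p : Fin 5 => j.gradient (tedH 𝕜 p))) =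
      Submodule.span 𝕜 (Set.range
        (fun p : {p : Fin 5 // p ≠ i ∧ p ≠ k} => j.gradient (tedH 𝕜 p))) := by
    apply le_antisymm
    · rw [Submodule.span_le]
      rintro _ ⟨p, rfl⟩
      simp only [gradient_tedH]
      refine polarH_mem_span (isSkew_omegaAt j) ⟨fun i => ?_, fun i k => ?_⟩ h
        (fun p => by rw [← eval_tedH, H]) p
      · funext μ; simp
      · funext μ; simp
    · refine Submodule.span_mono ?_
      rintro _ ⟨p, rfl⟩
      exact ⟨p, rfl⟩
  rw [hspan, finrank_span_eq_card (linearIndependent_gradient_tedH h)]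
  clear hspan h H
  revert i k; decide

end Field

/-! ### Order and regularity of the system -/

section Regular

/-- Differential polynomials of order at most `n`. -/
def orderLE (𝕜 ι : Type*) [CommRing 𝕜] (n : ℕ) : Subalgebra 𝕜 (DiffPoly 𝕜 ι) :=
  MvPolynomial.supported 𝕜 {s | ∀ μ, s = Sum.inr μ → μ.degree ≤ n}

theorem orderLE_mono {ι : Type*} [CommRing 𝕜] {m n : ℕ} (h : m ≤ n) :
    orderLE 𝕜 ι m ≤ orderLE 𝕜 ι n :=
  MvPolynomial.supported_mono fun _ hs μ hμ => (hs μ hμ).trans h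

theorem X_inr_mem_orderLE {ι : Type*} [CommRing 𝕜] {n : ℕ} {μ : ι →₀ ℕ} (h : μ.degree ≤ n) :
    (MvPolynomial.X (Sum.inr μ) : DiffPoly 𝕜 ι) ∈ orderLE 𝕜 ι n := by
  apply Algebra.subset_adjoin
  refine ⟨_, ?_, rfl⟩
  rintro ν hν
  rw [← Sum.inr.inj hν]; exact h

theorem tedOmega_mem_orderLE [CommRing 𝕜] (i k : Fin 5) :
    tedOmega 𝕜 i k ∈ orderLE 𝕜 (Fin 5 ⊕ Fin 5) 2 :=
  sub_mem (X_inr_mem_orderLE (degree_xy _ _).le) (X_inr_mem_orderLE (degree_xy _ _).le)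

theorem pfH_mem {K R : Type*} [CommRing K] [CommRing R] [Algebra K R] (A : Subalgebra K R)
    {w : Fin 5 → Fin 5 → R} (hw : ∀ i k, w i k ∈ A) (p : Fin 5) : pfH w p ∈ A := by
  fin_cases p <;> exact add_mem (add_mem (mul_mem (hw _ _) (hw _ _))
    (mul_mem (hw _ _) (hw _ _))) (mul_mem (hw _ _) (hw _ _))

theorem tedH_mem_orderLE [CommRing 𝕜] (p : Fin 5) :
    tedH 𝕜 p ∈ orderLE 𝕜 (Fin 5 ⊕ Fin 5) 2 := by
  rw [tedH_eq]; exact pfH_mem _ tedOmega_mem_orderLE p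

theorem continuous_jet_eval [RCLike 𝕜] {ι : Type*} {q : ℕ} (F : DiffPoly 𝕜 ι) :
    Continuous (fun j : Jet 𝕜 ι q => j.eval F) := by
  refine (MvPolynomial.continuous_eval F).comp (continuous_pi ?_)
  rintro (i | μ)
  · exact (continuous_apply i).comp continuous_fst
  · simp only [Sum.elim_inr]
    split_ifs with h
    · exact (continuous_apply _).comp continuous_snd
    · exact continuous_const

theorem isOpen_tedDomain [RCLike 𝕜] : IsOpen (tedDomain 𝕜) := by
  simp only [tedDomain, Set.ofPred_exists]
  exact isOpen_iUnion fun i => isOpen_iUnion fun k =>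
    isOpen_ne_fun (continuous_jet_eval _) continuous_const

/-- Over each point of the base there is the jet with `ω = e₀ ∧ e₁`, and near a point with
`ω_{ik} ≠ 0` the three equations containing the indices `i, k` suffice. -/
theorem isFibredSubmanifold_ted [RCLike 𝕜] : IsFibredSubmanifold 2 (tedH 𝕜) (tedDomain 𝕜) 3 := by
  refine ⟨fun x => ?_, ?_⟩
  · let j : Jet 𝕜 (Fin 5 ⊕ Fin 5) 2 := (x, fun μ => if μ.1 = xy 0 1 then 1 else 0)
    have hj : omegaAt j = wedgeE 𝕜 0 1 := by
      funext i k
      simp [omegaAt, tedOmega_eq, Jet.eval_eq, Jet.coord, j, degree_xy, xy_inj, wedgeE]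
    refine ⟨j, ⟨0, 1, ?_⟩, rfl, fun p => ?_⟩
    · change omegaAt j 0 1 ≠ 0
      rw [hj]; simp [wedgeE]
    · rw [eval_tedH, hj]
      fin_cases p <;> simp [pfH, pf, wedgeE]
  · rintro j ⟨i, k, hik⟩ H
    have hne : i ≠ k := by rintro rfl; exact hik ((isSkew_omegaAt j).diag i)
    refine ⟨Finset.univ.filter fun p => p ≠ i ∧ p ≠ k, ?_, ?_, ?_⟩
    · clear H hik; revert i k; decide
    · exact (linearIndependent_gradient_tedH hik).comp
        (fun a : {x // x ∈ Finset.univ.filter fun p => p ≠ i ∧ p ≠ k} =>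
          (⟨a.1, (Finset.mem_filter.1 a.2).2⟩ : {p : Fin 5 // p ≠ i ∧ p ≠ k}))
        (fun a b h => Subtype.ext (congrArg (fun z => z.1) h))
    · filter_upwards [(continuous_jet_eval (tedOmega 𝕜 i k)).continuousAt.eventually_ne hik]
        with j' hj' h'
      simp only [eval_tedH] at h' ⊢
      exact (pfH_eq_zero_iff (isSkew_omegaAt j') hj').2
        fun p h1 h2 => h' p (Finset.mem_filter.2 ⟨Finset.mem_univ _, h1, h2⟩)

end Regular

end TED

/-! ### Syzygies of the minors of a generic `2 × 3` matrix -/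

theorem MvPolynomial.sub_aeval_mem_span {K σ : Type*} [CommRing K] (ε : σ → MvPolynomial σ K)
    (I : Ideal (MvPolynomial σ K)) (h : ∀ i, MvPolynomial.X i - ε i ∈ I)
    (p : MvPolynomial σ K) : p - MvPolynomial.aeval ε p ∈ I := by
  rw [← Ideal.Quotient.eq]
  have : Ideal.Quotient.mkₐ K I = (Ideal.Quotient.mkₐ K I).comp (MvPolynomial.aeval ε) := by
    ext i
    simpa using (Ideal.Quotient.eq).2 (h i)
  exact DFunLike.congr_fun this p

open MvPolynomial in
theorem MvPolynomial.irreducible_minor {K σ : Type*} [Field K] {a b c d : σ}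
    (hab : a ≠ b) (hac : a ≠ c) (had : a ≠ d) (hbc : b ≠ c) (hbd : b ≠ d) :
    Irreducible (X b * X a - X c * X d : MvPolynomial σ K) := by
  classical
  rw [sub_eq_add_neg]
  apply irreducible_mul_X_add
  · exact X_ne_zero b
  · simp [vars_X, hab]
  · rw [vars_neg]
    intro h
    have := vars_mul _ _ h
    simp [vars_X, hac, had] at this
  · rw [IsRelPrime.neg_right_iff]
    rw [Irreducible.isRelPrime_iff_not_dvd (X_prime).irreducible]
    rw [X_prime.dvd_mul]
    simp [X_dvd_X, hbc, hbd]

open MvPolynomial in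
/-- The syzygies of the maximal minors of a generic `2 × 3` matrix are generated by the two rows
of the matrix (the Hilbert–Burch theorem in this case). -/
theorem MvPolynomial.exists_of_sum_mul_minor_eq_zero {K σ : Type*} [Field K]
    {x y : Fin 3 → σ} (hx : Function.Injective x) (hy : Function.Injective y)
    (hxy : ∀ i k, x i ≠ y k) (g : Fin 3 → MvPolynomial σ K)
    (hg : g 0 * (X (x 1) * X (y 2) - X (x 2) * X (y 1)) +
      g 1 * (X (x 2) * X (y 0) - X (x 0) * X (y 2)) +
      g 2 * (X (x 0) * X (y 1) - X (x 1) * X (y 0)) = 0) :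
    ∃ α β : MvPolynomial σ K, ∀ q, g q = α * X (x q) + β * X (y q) := by
  classical
  have hx' : ∀ i k, x i = x k ↔ i = k := fun i k => hx.eq_iff
  have hy' : ∀ i k, y i = y k ↔ i = k := fun i k => hy.eq_iff
  have hyx : ∀ i k, y i ≠ x k := fun i k => (hxy k i).symm
  -- Modulo `X (x 2)` and `X (y 2)` only the last minor survives.
  obtain ⟨α, β, hαβ⟩ : ∃ α β, α * X (x 2) + β * X (y 2) = g 2 := by
    rw [← Ideal.mem_span_pair]
    let ε : σ → MvPolynomial σ K := fun i => if i = x 2 ∨ i = y 2 then 0 else X i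
    have h1 := MvPolynomial.sub_aeval_mem_span ε (Ideal.span {X (x 2), X (y 2)})
      (fun i => by
        by_cases h : i = x 2 ∨ i = y 2
        · simp only [ε, h, if_true, sub_zero]
          rcases h with rfl | rfl <;> exact Ideal.subset_span (by simp)
        · simp [ε, h]) (g 2)
    have h2 := congrArg (aeval ε) hg
    simp [ε, hx', hy', hxy, hyx] at h2
    rcases h2 with h2 | h2
    · rw [show (aeval ε) (g 2) = 0 from h2, sub_zero] at h1
      exact h1
    · exfalso
      have := congrArg (eval (fun i => if i = x 0 ∨ i = y 1 then (1 : K) else 0)) h2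
      simp [hx', hy', hxy, hyx] at this
  have hirr : Irreducible (X (y 2) * X (x 1) - X (x 2) * X (y 1) : MvPolynomial σ K) :=
    irreducible_minor (hxy _ _) (by simp [hx']) (hxy _ _) (hyx _ _) (by simp [hy'])
  have hdvd : (X (y 2) * X (x 1) - X (x 2) * X (y 1) : MvPolynomial σ K) ∣
      g 1 - α * X (x 1) - β * X (y 1) := by
    have h3 : (X (y 2) * X (x 1) - X (x 2) * X (y 1) : MvPolynomial σ K) ∣
      (g 1 - α * X (x 1) - β * X (y 1)) * (X (x 0) * X (y 2) - X (x 2) * X (y 0)) :=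
      ⟨g 0 - α * X (x 0) - β * X (y 0), by rw [← hαβ] at hg; linear_combination -hg⟩
    rcases hirr.prime.dvd_or_dvd h3 with h | ⟨c, h⟩
    · exact h
    · exfalso
      have := congrArg (eval (fun i => if i = x 0 ∨ i = y 2 then (1 : K) else 0)) h
      simp [hx', hy', hxy, hyx] at this
  obtain ⟨h, hh⟩ := hdvd
  have hh0 : g 0 - α * X (x 0) - β * X (y 0) = h * (X (x 0) * X (y 2) - X (x 2) * X (y 0)) := by
    apply mul_left_cancel₀ hirr.ne_zero
    rw [← hαβ] at hg
    linear_combination hg + (X (x 0) * X (y 2) - X (x 2) * X (y 0)) * hh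
  refine ⟨α + h * X (y 2), β - h * X (x 2), fun q => ?_⟩
  fin_cases q
  · simp only [Fin.zero_eta]; linear_combination hh0
  · simp only [Fin.mk_one]; linear_combination hh
  · simp only [Fin.reduceFinMk]; linear_combination -hαβ

/-! ### Linear substitutions and adapted coordinates -/

section LinearSubstitution

variable {K ι κ : Type*} [Field K] [Fintype ι] [Fintype κ]

/-- The linear form `∑ wᵢ Xᵢ`. -/
def linForm : (ι → K) →ₗ[K] MvPolynomial ι K := Fintype.linearCombination K MvPolynomial.X

theorem linForm_apply (w : ι → K) : linForm w = ∑ i, w i • MvPolynomial.X i := rfl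

@[simp]
theorem linForm_single [DecidableEq ι] (i : ι) :
    linForm (Pi.single i (1 : K)) = MvPolynomial.X i := by
  simp [linForm]

theorem aeval_linForm (c : κ → ι → K) (w : κ → K) :
    MvPolynomial.aeval (fun m => linForm (c m)) (linForm w) = linForm (∑ m, w m • c m) := by
  rw [linForm_apply]
  simp

/-- The linear change of variables `X m ↦ ∑ᵢ (b m)ᵢ Xᵢ` given by a basis `b`. -/
def linSubst (b : Module.Basis κ K (ι → K)) : MvPolynomial κ K ≃ₐ[K] MvPolynomial ι K := by
  classical
  exact AlgEquiv.ofAlgHom (MvPolynomial.aeval fun m => linForm (b m))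
    (MvPolynomial.aeval fun i => linForm (b.equivFun (Pi.single i 1)))
    (by
      ext i : 1
      simp only [AlgHom.comp_apply, MvPolynomial.aeval_X, aeval_linForm, b.sum_equivFun]
      simp)
    (by
      ext m : 1
      simp only [AlgHom.comp_apply, MvPolynomial.aeval_X, aeval_linForm]
      have : ∑ i, b m i • b.equivFun (Pi.single i 1) = Pi.single m 1 := by
        simp_rw [← map_smul]
        rw [← map_sum, ← pi_eq_sum_univ' (b m)]
        ext k
        rw [b.equivFun_self]
        simp [Pi.single_apply, eq_comm]
      rw [this]
      simp)

theorem linSubst_X (b : Module.Basis κ K (ι → K)) (m : κ) :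
    linSubst b (MvPolynomial.X m) = linForm (b m) := by
  simp [linSubst]

end LinearSubstitution

section Adapted

variable {K : Type*} [Field K]

/-- The frame obtained from `ξ` by the change of basis that brings a decomposable `w` with
`w 0 1 ≠ 0` into the form `e₀ ∧ e₁` up to a factor. -/
def shearFrame {A : Type*} [AddCommGroup A] [Module K A] (w : Fin 5 → Fin 5 → K)
    (ξ : Fin 5 → A) : Fin 5 → A :=
  ![ξ 0, ξ 1, shear w ξ 2, shear w ξ 3, shear w ξ 4]

theorem map_shearFrame {A B : Type*} [AddCommGroup A] [Module K A] [AddCommGroup B] [Module K B]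
    (φ : A →ₗ[K] B) (w : Fin 5 → Fin 5 → K) (ξ : Fin 5 → A) (p : Fin 5) :
    φ (shearFrame w ξ p) = shearFrame w (fun q => φ (ξ q)) p := by
  fin_cases p <;> simp [shearFrame, shear]

/-- The vectors of the basis `adaptedBasis`. -/
def adaptedVec (w : Fin 5 → Fin 5 → K) (σ : Equiv.Perm (Fin 5)) :
    Fin 5 ⊕ Fin 5 → (Fin 5 ⊕ Fin 5 → K) :=
  Sum.elim (shearFrame w fun q => Pi.single (Sum.inl (σ q)) 1)
    (shearFrame w fun q => Pi.single (Sum.inr (σ q)) 1)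

theorem linearIndependent_adaptedVec (w : Fin 5 → Fin 5 → K) (σ : Equiv.Perm (Fin 5)) :
    LinearIndependent K (adaptedVec w σ) := by
  rw [Fintype.linearIndependent_iff]
  intro g hg
  have hl : ∀ q, g (Sum.inl q) = 0 := by
    have h := fun q => congrFun hg (Sum.inl (σ q))
    simp [Fin.sum_univ_five, adaptedVec, shearFrame, shear, Pi.single_apply] at h
    have h2 := h 2
    have h3 := h 3
    have h4 := h 4
    simp at h2 h3 h4
    have h0 := h 0
    have h1 := h 1
    simp [h2, h3, h4] at h0 h1
    intro q; fin_cases q <;> assumption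
  have hr : ∀ q, g (Sum.inr q) = 0 := by
    have h := fun q => congrFun hg (Sum.inr (σ q))
    simp [Fin.sum_univ_five, adaptedVec, shearFrame, shear, Pi.single_apply] at h
    have h2 := h 2
    have h3 := h 3
    have h4 := h 4
    simp at h2 h3 h4
    have h0 := h 0
    have h1 := h 1
    simp [h2, h3, h4] at h0 h1
    intro q; fin_cases q <;> assumption
  rintro (q | q)
  · exact hl q
  · exact hr q

/-- The basis of the space of symbol variables in which a decomposable `w` with `w 0 1 ≠ 0`
takes the form `e₀ ∧ e₁` up to a factor; the same change of basis is made in the `x` and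
in the `y`, after the renumbering `σ`. -/
def adaptedBasis (w : Fin 5 → Fin 5 → K) (σ : Equiv.Perm (Fin 5)) :
    Module.Basis (Fin 5 ⊕ Fin 5) K (Fin 5 ⊕ Fin 5 → K) :=
  basisOfLinearIndependentOfCardEqFinrank (linearIndependent_adaptedVec w σ) (by simp)

theorem linSubst_adaptedBasis_inl (w : Fin 5 → Fin 5 → K) (σ : Equiv.Perm (Fin 5)) (p : Fin 5) :
    linSubst (adaptedBasis w σ) (MvPolynomial.X (Sum.inl p)) =
      shearFrame w (fun q => MvPolynomial.X (Sum.inl (σ q))) p := by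
  simp [linSubst_X, adaptedBasis, adaptedVec, map_shearFrame]

theorem linSubst_adaptedBasis_inr (w : Fin 5 → Fin 5 → K) (σ : Equiv.Perm (Fin 5)) (p : Fin 5) :
    linSubst (adaptedBasis w σ) (MvPolynomial.X (Sum.inr p)) =
      shearFrame w (fun q => MvPolynomial.X (Sum.inr (σ q))) p := by
  simp [linSubst_X, adaptedBasis, adaptedVec, map_shearFrame]

end Adapted

/-! ### Solvability of the linearized system -/

section Solvability

variable {K : Type*} [Field K]

/-- The symbol of `ω_{ik}`. -/
def symbolOmega (K : Type*) [CommRing K] (i k : Fin 5) : MvPolynomial (Fin 5 ⊕ Fin 5) K :=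
  MvPolynomial.X (Sum.inl i) * MvPolynomial.X (Sum.inr k) -
    MvPolynomial.X (Sum.inl k) * MvPolynomial.X (Sum.inr i)

theorem isSkew_symbolOmega : IsSkew (symbolOmega K) :=
  ⟨fun i => by simp [symbolOmega], fun i k => by simp [symbolOmega]⟩

theorem polarH_self (w : Fin 5 → Fin 5 → K) (p : Fin 5) : polarH w w p = 2 * pfH w p := by
  fin_cases p <;> simp [polarH, pfPolar, pfH, pf] <;> ring

theorem pfH_comp_perm_eq_zero [CharZero K] (σ : Equiv.Perm (Fin 5)) {w : Fin 5 → Fin 5 → K}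
    (hw : IsSkew w) (H : ∀ p, pfH w p = 0) (p : Fin 5) :
    pfH (fun i k => w (σ i) (σ k)) p = 0 := by
  have h := polarH_comp_perm σ hw hw p
  rw [polarH_self, polarH_self, H] at h
  simpa using h

/-- If the family `B` is annihilated by `w`, then the rows `0, 1` of this relation allow to eliminate
`B 0` and `B 1` from the pairing of `B` with `g`; the new coefficients are `shear w g`. -/
theorem sum_apply_eq_shear {A N : Type*} [AddCommGroup A] [Module K A] [AddCommGroup N]
    [Module K N] {w : Fin 5 → Fin 5 → K} (hw : IsSkew w) (h01 : w 0 1 ≠ 0)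
    (B : Fin 5 → A →ₗ[K] N) (h : ∀ i, ∑ k, w i k • B k = 0) (g : Fin 5 → A) :
    ∑ p, B p (g p) = B 2 (shear w g 2) + B 3 (shear w g 3) + B 4 (shear w g 4) := by
  have h0 := LinearMap.congr_fun (h 0) (g 1)
  have h1 := LinearMap.congr_fun (h 1) (g 0)
  simp only [Fin.sum_univ_five, LinearMap.add_apply, LinearMap.smul_apply, hw.diag,
    LinearMap.zero_apply, hw.swap 1 0] at h0 h1
  have h0' : B 1 (g 1) =
      -(w 0 1)⁻¹ • (w 0 2 • B 2 (g 1) + w 0 3 • B 3 (g 1) + w 0 4 • B 4 (g 1)) := by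
    have := congrArg ((w 0 1)⁻¹ • ·) h0
    simp only [smul_add, smul_zero, zero_smul, smul_smul, inv_mul_cancel₀ h01, one_smul,
      zero_add] at this
    rw [← sub_eq_zero, ← this]
    module
  have h1' : B 0 (g 0) =
      (w 0 1)⁻¹ • (w 1 2 • B 2 (g 0) + w 1 3 • B 3 (g 0) + w 1 4 • B 4 (g 0)) := by
    have := congrArg ((w 0 1)⁻¹ • ·) h1
    simp only [smul_add, smul_zero, zero_smul, smul_smul, neg_smul, smul_neg,
      inv_mul_cancel₀ h01, one_smul] at this
    rw [← sub_eq_zero, ← neg_eq_zero, ← this]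
    module
  simp only [Fin.sum_univ_five, shear, map_add, map_sub, map_smul, h0', h1']
  module

theorem shear_mul {S : Type*} [CommRing S] [Algebra K S] (w : Fin 5 → Fin 5 → K)
    (f : S) (ξ : Fin 5 → S) (q : Fin 5) :
    shear w (fun p => f * ξ p) q = f * shear w ξ q := by
  simp only [shear, mul_add, mul_sub, mul_smul_comm]

open MvPolynomial in
/-- The case of `exists_functional` in which `ω_{ik} ≠ 0` for the first two of the renumbered
indices. A functional on the ideal of the `mₚ` is well defined if the prescribed values respect the
syzygies, and after elimination of the indices `0, 1` these are given by the Hilbert–Burch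
theorem. -/
theorem exists_functional_of_zero_one {w : Fin 5 → Fin 5 → K} (hw : IsSkew w) (h01 : w 0 1 ≠ 0)
    (H : ∀ p, pfH w p = 0) (σ : Equiv.Perm (Fin 5))
    (G : Fin 5 → MvPolynomial (Fin 5 ⊕ Fin 5) K →ₗ[K] K)
    (hx : ∀ f, ∑ p, G p (f * X (Sum.inl (σ p))) = 0)
    (hy : ∀ f, ∑ p, G p (f * X (Sum.inr (σ p))) = 0)
    (hG : ∀ i, ∑ k, w i k • G k = 0) :
    ∃ L : MvPolynomial (Fin 5 ⊕ Fin 5) K →ₗ[K] K, ∀ p f,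
      L (f * polarH w (fun i k => symbolOmega K (σ i) (σ k)) p) = G p f := by
  set m := polarH w (fun i k => symbolOmega K (σ i) (σ k)) with hm
  let φ : (Fin 5 → MvPolynomial (Fin 5 ⊕ Fin 5) K) →ₗ[K] MvPolynomial (Fin 5 ⊕ Fin 5) K :=
    LinearMap.lsum K _ K fun p => LinearMap.mulRight K (m p)
  let Γ : (Fin 5 → MvPolynomial (Fin 5 ⊕ Fin 5) K) →ₗ[K] K := LinearMap.lsum K _ K G
  have hφ : ∀ g, φ g = ∑ p, g p * m p := fun g => by simp [φ, LinearMap.lsum_apply]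
  have hΓ : ∀ g, Γ g = ∑ p, G p (g p) := fun g => by simp [Γ, LinearMap.lsum_apply]
  -- `Γ` factors through `φ` if it vanishes on the syzygies.
  have hker : Γ ∈ (LinearMap.ker φ).dualAnnihilator := by
    rw [Submodule.mem_dualAnnihilator]
    intro g hg
    rw [LinearMap.mem_ker, hφ] at hg
    rw [hΓ, sum_apply_eq_shear hw h01 G hG]
    have h1 := sum_apply_eq_shear hw h01 (fun p => LinearMap.mulRight K (m p)) (fun i => by
      have := sum_smul_polarH hw (isSkew_symbolOmega (K := K).comp σ) i
      refine LinearMap.ext fun f => ?_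
      simp only [H, zero_smul, Finset.sum_const_zero, neg_zero] at this
      simp only [LinearMap.sum_apply, LinearMap.smul_apply, LinearMap.mulRight_apply,
        LinearMap.zero_apply, ← mul_smul_comm, ← Finset.mul_sum]
      rw [hm, this, mul_zero]) g
    simp only [LinearMap.mulRight_apply, hg] at h1
    obtain ⟨e2, e3, e4⟩ := polarH_eq_minor hw h01 H
      (fun q => (X (Sum.inl (σ q)) : MvPolynomial (Fin 5 ⊕ Fin 5) K)) (fun q => X (Sum.inr (σ q)))
    have hm' : m = polarH w (fun i k => (X (Sum.inl (σ i)) : MvPolynomial (Fin 5 ⊕ Fin 5) K) *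
      X (Sum.inr (σ k)) - X (Sum.inl (σ k)) * X (Sum.inr (σ i))) := rfl
    rw [hm', e2, e3, e4] at h1
    simp only [mul_smul_comm, ← smul_add] at h1
    have h2 := (smul_eq_zero.1 h1.symm).resolve_left h01
    -- In adapted coordinates the three minors are those of a generic matrix.
    set ψ := linSubst (adaptedBasis w σ) with hψ
    have hl := linSubst_adaptedBasis_inl w σ
    have hr := linSubst_adaptedBasis_inr w σ
    rw [← hψ] at hl hr
    have hl' : ∀ q : Fin 3, shear w (fun q => X (Sum.inl (σ q))) (![2, 3, 4] q) =
        ψ (X (Sum.inl (![2, 3, 4] q))) := by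
      intro q; rw [hl]; fin_cases q <;> rfl
    have hr' : ∀ q : Fin 3, shear w (fun q => X (Sum.inr (σ q))) (![2, 3, 4] q) =
        ψ (X (Sum.inr (![2, 3, 4] q))) := by
      intro q; rw [hr]; fin_cases q <;> rfl
    have hinj : Function.Injective (![2, 3, 4] : Fin 3 → Fin 5) := by decide
    obtain ⟨α, β, hαβ⟩ := exists_of_sum_mul_minor_eq_zero
      (x := fun q : Fin 3 => (Sum.inl (![2, 3, 4] q : Fin 5) : Fin 5 ⊕ Fin 5))
      (y := fun q : Fin 3 => (Sum.inr (![2, 3, 4] q : Fin 5) : Fin 5 ⊕ Fin 5))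
      (Sum.inl_injective.comp hinj) (Sum.inr_injective.comp hinj) (by simp)
      (fun q => ψ.symm (shear w g (![2, 3, 4] q))) (by
        apply ψ.injective
        simp only [map_add, map_mul, map_sub, AlgEquiv.apply_symm_apply, map_zero, ← hl', ← hr']
        exact h2)
    have h3 : ∀ q : Fin 3, shear w g (![2, 3, 4] q) =
        shear w (fun p => ψ α * X (Sum.inl (σ p))) (![2, 3, 4] q) +
          shear w (fun p => ψ β * X (Sum.inr (σ p))) (![2, 3, 4] q) := by
      intro q
      rw [shear_mul, shear_mul, hl', hr', ← map_mul, ← map_mul, ← map_add, ← hαβ q,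
        AlgEquiv.apply_symm_apply]
    have hx' := hx (ψ α)
    have hy' := hy (ψ β)
    rw [sum_apply_eq_shear hw h01 G hG] at hx' hy'
    have h32 := h3 0
    have h33 := h3 1
    have h34 := h3 2
    simp only [Matrix.cons_val] at h32 h33 h34
    rw [h32, h33, h34]
    simp only [map_add]
    linear_combination hx' + hy'
  rw [← LinearMap.range_dualMap_eq_dualAnnihilator_ker] at hker
  obtain ⟨L, hL⟩ := hker
  refine ⟨L, fun p f => ?_⟩
  have := LinearMap.congr_fun hL (Pi.single p f)
  rw [LinearMap.dualMap_apply, hφ, hΓ] at this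
  rw [Finset.sum_eq_single p, Finset.sum_eq_single p] at this
  · simpa using this
  all_goals simp +contextual

open MvPolynomial in
/-- Exactness of the linearized system: the inhomogeneous equations `L (f * mₚ) = Gₚ f`, where
`mₚ` is the symbol of the `p`-th equation, are solvable as soon as the `Gₚ` satisfy the evident
compatibility conditions, those coming from `d_x ω = 0`, `d_y ω = 0` and from the algebraic
relations between the Pfaffians. -/
theorem exists_functional [CharZero K] {w : Fin 5 → Fin 5 → K} (hw : IsSkew w) {i k : Fin 5}
    (hik : w i k ≠ 0) (H : ∀ p, pfH w p = 0)
    (G : Fin 5 → MvPolynomial (Fin 5 ⊕ Fin 5) K →ₗ[K] K)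
    (hx : ∀ f, ∑ p, G p (f * X (Sum.inl p)) = 0)
    (hy : ∀ f, ∑ p, G p (f * X (Sum.inr p)) = 0)
    (hG : ∀ i, ∑ k, w i k • G k = 0) :
    ∃ L : MvPolynomial (Fin 5 ⊕ Fin 5) K →ₗ[K] K, ∀ p f,
      L (f * polarH w (symbolOmega K) p) = G p f := by
  have hne : i ≠ k := by rintro rfl; exact hik (hw.diag i)
  obtain ⟨σ, rfl, rfl⟩ := exists_perm_of_ne hne
  have H' := pfH_comp_perm_eq_zero σ hw H
  obtain ⟨L, hL⟩ := exists_functional_of_zero_one (hw.comp σ) hik H' σ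
    (fun p => (Equiv.Perm.sign σ : ℤ) • G (σ p))
    (fun f => by
      have := hx f
      rw [← Equiv.sum_comp σ] at this
      simp only [LinearMap.smul_apply, ← Finset.smul_sum, this, smul_zero])
    (fun f => by
      have := hy f
      rw [← Equiv.sum_comp σ] at this
      simp only [LinearMap.smul_apply, ← Finset.smul_sum, this, smul_zero])
    (fun i => by
      have := hG (σ i)
      rw [← Equiv.sum_comp σ] at this
      simp only [smul_comm _ (_ : ℤ), ← Finset.smul_sum, this, smul_zero])
  refine ⟨L, fun p f => ?_⟩
  obtain ⟨p, rfl⟩ := σ.surjective p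
  have h := hL p f
  rw [polarH_comp_perm σ hw isSkew_symbolOmega, mul_smul_comm, map_zsmul,
    LinearMap.smul_apply] at h
  rcases Int.units_eq_one_or (Equiv.Perm.sign σ) with hs | hs <;> simpa [hs] using h

end Solvability

/-! ### Iterated total derivatives -/

section TotalDerivatives

variable {𝕜 ι : Type*} [CommRing 𝕜] [DecidableEq ι]

@[simp]
theorem totalDeriv_X_inr (i : ι) (μ : ι →₀ ℕ) :
    totalDeriv 𝕜 i (MvPolynomial.X (Sum.inr μ)) =
      MvPolynomial.X (Sum.inr (μ + Finsupp.single i 1)) := by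
  simp [totalDeriv, MvPolynomial.mkDerivation_X]

theorem totalDeriv_X_inl (i k : ι) :
    totalDeriv 𝕜 i (MvPolynomial.X (Sum.inl k)) = if k = i then 1 else 0 := by
  simp [totalDeriv, MvPolynomial.mkDerivation_X]

theorem totalDeriv_comm (i k : ι) (F : DiffPoly 𝕜 ι) :
    totalDeriv 𝕜 i (totalDeriv 𝕜 k F) = totalDeriv 𝕜 k (totalDeriv 𝕜 i F) := by
  have h : ⁅totalDeriv 𝕜 i, totalDeriv 𝕜 k⁆ = 0 := by
    apply MvPolynomial.derivation_ext
    rintro (m | μ)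
    · simp only [Derivation.commutator_apply, totalDeriv_X_inl, Derivation.coe_zero,
        Pi.zero_apply]
      split_ifs <;> simp
    · simp [Derivation.commutator_apply, add_right_comm]
  have := Derivation.congr_fun h F
  rw [Derivation.commutator_apply] at this
  exact sub_eq_zero.1 this

@[simp]
theorem totalDerivs_nil (F : DiffPoly 𝕜 ι) : totalDerivs [] F = F := rfl

@[simp]
theorem totalDerivs_cons (i : ι) (l : List ι) (F : DiffPoly 𝕜 ι) :
    totalDerivs (i :: l) F = totalDeriv 𝕜 i (totalDerivs l F) := rfl

theorem totalDerivs_append (l l' : List ι) (F : DiffPoly 𝕜 ι) :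
    totalDerivs (l ++ l') F = totalDerivs l (totalDerivs l' F) := by
  simp [totalDerivs]

theorem totalDerivs_perm {l l' : List ι} (h : l.Perm l') (F : DiffPoly 𝕜 ι) :
    totalDerivs l F = totalDerivs l' F := by
  induction h with
  | nil => rfl
  | cons i _ ih => simp [ih]
  | swap i k l => simp [totalDeriv_comm i k]
  | trans _ _ h1 h2 => exact h1.trans h2

theorem totalDerivs_add (l : List ι) (F F' : DiffPoly 𝕜 ι) :
    totalDerivs l (F + F') = totalDerivs l F + totalDerivs l F' := by
  induction l with
  | nil => rfl
  | cons i l ih => simp [ih]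

theorem totalDerivs_sub (l : List ι) (F F' : DiffPoly 𝕜 ι) :
    totalDerivs l (F - F') = totalDerivs l F - totalDerivs l F' := by
  induction l with
  | nil => rfl
  | cons i l ih => simp [ih]

theorem totalDerivs_zero (l : List ι) : totalDerivs l (0 : DiffPoly 𝕜 ι) = 0 := by
  induction l with
  | nil => rfl
  | cons i l ih => simp [ih]

theorem totalDerivs_sum {α : Type*} (s : Finset α) (l : List ι) (F : α → DiffPoly 𝕜 ι) :
    totalDerivs l (∑ a ∈ s, F a) = ∑ a ∈ s, totalDerivs l (F a) := by
  induction l with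
  | nil => rfl
  | cons i l ih => simp [ih]

/-- The multi-index of the derivative along a list of indices. -/
def listIndex (l : List ι) : ι →₀ ℕ := (l.map fun i => Finsupp.single i 1).sum

theorem totalDerivs_X_inr (l : List ι) (μ : ι →₀ ℕ) :
    totalDerivs l (MvPolynomial.X (Sum.inr μ) : DiffPoly 𝕜 ι) =
      MvPolynomial.X (Sum.inr (μ + listIndex l)) := by
  induction l with
  | nil => simp [listIndex]
  | cons i l ih =>
    simp only [totalDerivs_cons, ih, totalDeriv_X_inr, listIndex, List.map_cons, List.sum_cons]
    congr 2
    abel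

theorem degree_listIndex {ι : Type*} (l : List ι) : (listIndex l).degree = l.length := by
  induction l with
  | nil => simp [listIndex]
  | cons i l ih => simp_all [listIndex, add_comm]

theorem toMultiset_listIndex {ι : Type*} (l : List ι) :
    Finsupp.toMultiset (listIndex l) = (l : Multiset ι) := by
  induction l with
  | nil => simp [listIndex]
  | cons i l ih => simp_all [listIndex, Finsupp.toMultiset_single]

theorem perm_of_listIndex_eq {ι : Type*} {l l' : List ι} (h : listIndex l = listIndex l') : l.Perm l' := by
  rw [← Multiset.coe_eq_coe, ← toMultiset_listIndex, ← toMultiset_listIndex, h]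

theorem exists_listIndex_eq (ν : ι →₀ ℕ) : ∃ l : List ι, listIndex l = ν := by
  refine ⟨(Finsupp.toMultiset ν).toList, ?_⟩
  rw [← Finsupp.toMultiset_toFinsupp (listIndex _), toMultiset_listIndex, Multiset.coe_toList,
    Finsupp.toMultiset_toFinsupp]

theorem listIndex_append_singleton {ι : Type*} (l : List ι) (i : ι) :
    listIndex (l ++ [i]) = listIndex l + Finsupp.single i 1 := by
  simp [listIndex]

theorem totalDeriv_mem_orderLE {n : ℕ} (i : ι) {F : DiffPoly 𝕜 ι} (hF : F ∈ orderLE 𝕜 ι n) :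
    totalDeriv 𝕜 i F ∈ orderLE 𝕜 ι (n + 1) := by
  induction hF using Algebra.adjoin_induction with
  | mem x hx =>
    obtain ⟨s, hs, rfl⟩ := hx
    rcases s with k | μ
    · rw [totalDeriv_X_inl]
      split_ifs
      · exact one_mem _
      · exact zero_mem _
    · rw [totalDeriv_X_inr]
      exact X_inr_mem_orderLE (by simpa using hs μ rfl)
  | algebraMap r => rw [Derivation.map_algebraMap]; exact zero_mem _
  | add x y _ _ hx hy => rw [map_add]; exact add_mem hx hy
  | mul x y hx' hy' hx hy =>
    rw [Derivation.leibniz]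
    exact add_mem (mul_mem (orderLE_mono n.le_succ hx') hy)
      (mul_mem (orderLE_mono n.le_succ hy') hx)

theorem totalDerivs_mem_orderLE {n : ℕ} (l : List ι) {F : DiffPoly 𝕜 ι}
    (hF : F ∈ orderLE 𝕜 ι n) : totalDerivs l F ∈ orderLE 𝕜 ι (n + l.length) := by
  induction l with
  | nil => exact hF
  | cons i l ih => exact totalDeriv_mem_orderLE i ih

/-- The part of highest order of an iterated total derivative of a product. -/
theorem totalDerivs_mul_sub_mem_orderLE {P Q : DiffPoly 𝕜 ι} (hP : P ∈ orderLE 𝕜 ι 2)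
    (hQ : Q ∈ orderLE 𝕜 ι 2) (l : List ι) (hl : l ≠ []) :
    totalDerivs l (P * Q) - (P * totalDerivs l Q + Q * totalDerivs l P) ∈
      orderLE 𝕜 ι (1 + l.length) := by
  induction l with
  | nil => exact absurd rfl hl
  | cons i l ih =>
    by_cases h : l = []
    · subst h
      simp [Derivation.leibniz]
    · have h1 := totalDeriv_mem_orderLE i (ih h)
      have hlen : 1 ≤ l.length := List.length_pos_iff.2 h
      have hn : 2 + 1 ≤ 1 + (i :: l).length := by simp; omega
      have hn' : 2 + l.length ≤ 1 + (i :: l).length := by simp; omega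
      have hPi := orderLE_mono hn (totalDeriv_mem_orderLE i hP)
      have hQi := orderLE_mono hn (totalDeriv_mem_orderLE i hQ)
      have hPl := orderLE_mono hn' (totalDerivs_mem_orderLE l hP)
      have hQl := orderLE_mono hn' (totalDerivs_mem_orderLE l hQ)
      have h2 := add_mem h1 (add_mem (mul_mem hPi hQl) (mul_mem hQi hPl))
      refine (congrArg (· ∈ orderLE 𝕜 ι (1 + (i :: l).length)) ?_).mpr h2
      simp only [totalDerivs_cons, map_add, map_sub, Derivation.leibniz, smul_eq_mul]
      ring

/-- The part of highest order of an iterated total derivative of a Pfaffian. -/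
theorem totalDerivs_pfH_sub_mem_orderLE {w : Fin 5 → Fin 5 → DiffPoly 𝕜 ι}
    (hw : ∀ i k, w i k ∈ orderLE 𝕜 ι 2) (l : List ι) (hl : l ≠ []) (p : Fin 5) :
    totalDerivs l (pfH w p) - polarH w (fun i k => totalDerivs l (w i k)) p ∈
      orderLE 𝕜 ι (1 + l.length) := by
  have key : ∀ a b c d, totalDerivs l (pf w a b c d) -
      pfPolar w (fun i k => totalDerivs l (w i k)) a b c d ∈ orderLE 𝕜 ι (1 + l.length) := by
    intro a b c d
    have h := add_mem (add_mem
      (totalDerivs_mul_sub_mem_orderLE (hw a b) (hw c d) l hl)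
      (totalDerivs_mul_sub_mem_orderLE (hw b c) (hw a d) l hl))
      (totalDerivs_mul_sub_mem_orderLE (hw c a) (hw b d) l hl)
    convert h using 1
    simp only [pf, pfPolar, totalDerivs_add, smul_eq_mul]
    ring
  fin_cases p <;> exact key _ _ _ _

/-- Up to lower total derivatives of `F`, the iterated total derivative of `P * F` is `P` times
that of `F`. -/
theorem totalDerivs_mul_sub_mem_span (P F : DiffPoly 𝕜 ι) (l : List ι) :
    totalDerivs l (P * F) - P * totalDerivs l F ∈
      Ideal.span {G | ∃ l' : List ι, l'.length < l.length ∧ G = totalDerivs l' F} := by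
  induction l with
  | nil => simp
  | cons i l ih =>
    have hmono : ∀ {l' : List ι}, l'.length < l.length + 1 → totalDerivs l' F ∈
        Ideal.span {G | ∃ l' : List ι, l'.length < (i :: l).length ∧ G = totalDerivs l' F} :=
      fun h => Ideal.subset_span ⟨_, by simpa using h, rfl⟩
    have hD : ∀ G ∈ Ideal.span {G | ∃ l' : List ι, l'.length < l.length ∧ G = totalDerivs l' F},
        totalDeriv 𝕜 i G ∈
          Ideal.span {G | ∃ l' : List ι, l'.length < (i :: l).length ∧ G = totalDerivs l' F} := by
      intro G hG
      induction hG using Submodule.span_induction with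
      | mem x hx =>
        obtain ⟨l', hl', rfl⟩ := hx
        exact hmono (l' := i :: l') (by simpa using hl')
      | zero => simp
      | add x y _ _ hx hy => rw [map_add]; exact add_mem hx hy
      | smul a x hx' hx =>
        rw [smul_eq_mul, Derivation.leibniz]
        refine add_mem (Ideal.mul_mem_left _ _ hx) ?_
        rw [smul_eq_mul, mul_comm]
        refine Ideal.mul_mem_left _ _ (Ideal.span_mono ?_ hx')
        rintro _ ⟨l', h, rfl⟩
        exact ⟨l', by simp; omega, rfl⟩
    have h := add_mem (hD _ ih) (Ideal.mul_mem_left _ (totalDeriv 𝕜 i P) (hmono (l' := l) (by simp)))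
    convert h using 1
    simp only [totalDerivs_cons, map_sub, Derivation.leibniz, smul_eq_mul]
    ring

end TotalDerivatives

/-! ### Formal integrability -/

section FormalIntegrability

variable {𝕜 : Type*}

theorem MvPolynomial.eval_congr_of_mem_orderLE {ι : Type*} [CommRing 𝕜] {n : ℕ}
    {F : DiffPoly 𝕜 ι} (hF : F ∈ orderLE 𝕜 ι n) {u v : ι ⊕ (ι →₀ ℕ) → 𝕜}
    (hl : ∀ i, u (Sum.inl i) = v (Sum.inl i))
    (hr : ∀ μ : ι →₀ ℕ, μ.degree ≤ n → u (Sum.inr μ) = v (Sum.inr μ)) :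
    MvPolynomial.eval u F = MvPolynomial.eval v F := by
  induction hF using Algebra.adjoin_induction with
  | mem x hx =>
    obtain ⟨s, hs, rfl⟩ := hx
    rcases s with k | μ
    · simp [hl]
    · simp [hr μ (hs μ rfl)]
  | algebraMap r => simp [MvPolynomial.algebraMap_eq]
  | add x y _ _ hx hy => simp [hx, hy]
  | mul x y _ _ hx hy => simp [hx, hy]

variable [CommRing 𝕜]

/-- The identity `d_x (ω ∧ ω) = 0`. -/
theorem sum_totalDeriv_inl_tedH : ∑ p, totalDeriv 𝕜 (Sum.inl p) (tedH 𝕜 p) = 0 := by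
  simp only [tedH_eq, derivation_pfH]
  refine sum_polarH_of_closed isSkew_tedOmega
    (T := fun p i k => totalDeriv 𝕜 (Sum.inl p) (tedOmega 𝕜 i k)) (fun p => ⟨?_, ?_⟩) ?_
  · intro i; simp [isSkew_tedOmega.diag]
  · intro i k; rw [isSkew_tedOmega.swap i k, map_neg]
  · intro p i k
    simp only [tedOmega_eq, map_sub, totalDeriv_X_inr, xy]
    have e : ∀ a b c : (Fin 5 ⊕ Fin 5) →₀ ℕ, a + b + c = c + b + a := fun a b c => by abel
    rw [e _ (Finsupp.single (Sum.inr i) 1), e _ (Finsupp.single (Sum.inr k) 1),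
      e _ (Finsupp.single (Sum.inr p) 1)]
    ring

/-- The identity `d_y (ω ∧ ω) = 0`. -/
theorem sum_totalDeriv_inr_tedH : ∑ p, totalDeriv 𝕜 (Sum.inr p) (tedH 𝕜 p) = 0 := by
  simp only [tedH_eq, derivation_pfH]
  refine sum_polarH_of_closed isSkew_tedOmega
    (T := fun p i k => totalDeriv 𝕜 (Sum.inr p) (tedOmega 𝕜 i k)) (fun p => ⟨?_, ?_⟩) ?_
  · intro i; simp [isSkew_tedOmega.diag]
  · intro i k; rw [isSkew_tedOmega.swap i k, map_neg]
  · intro p i k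
    simp only [tedOmega_eq, map_sub, totalDeriv_X_inr, xy]
    rw [add_right_comm _ (Finsupp.single (Sum.inr i) 1) (Finsupp.single (Sum.inr k) 1),
      add_right_comm _ (Finsupp.single (Sum.inr k) 1) (Finsupp.single (Sum.inr p) 1),
      add_right_comm _ (Finsupp.single (Sum.inr p) 1) (Finsupp.single (Sum.inr i) 1)]
    ring

end FormalIntegrability

section Extension

variable {𝕜 : Type*} [Field 𝕜] [CharZero 𝕜]

/-- Formal integrability of the TED system: a jet of order `2 + r` on the `r`-th prolongation
extends to one of order `2 + r + 1` on the next. The derivatives of top order solve an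
inhomogeneous linear system with the symbol of the equations on the left; the right-hand sides
are (up to sign) the values of the total derivatives of order `r + 1` at the extension by zero, and
these meet the compatibility conditions of `exists_functional`. -/
theorem exists_prolongation_extension (r : ℕ) (j : Jet 𝕜 (Fin 5 ⊕ Fin 5) (2 + r))
    (hj : j ∈ prolongation 2 (tedH 𝕜) (tedDomain 𝕜) r) :
    ∃ j' ∈ prolongation 2 (tedH 𝕜) (tedDomain 𝕜) (r + 1), Jet.proj (by omega) j' = j := by
  obtain ⟨⟨i, k, hik⟩, hj⟩ := hj
  set w := omegaAt j with hw_def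
  have hw : IsSkew w := isSkew_omegaAt j
  have hproj : ∀ {q' : ℕ} (h : 2 ≤ q') (j' : Jet 𝕜 (Fin 5 ⊕ Fin 5) q') (i k : Fin 5),
      (j'.proj h).eval (tedOmega 𝕜 i k) = omegaAt j' i k := by
    intro q' h j' i k
    refine MvPolynomial.eval_congr_of_mem_orderLE (tedOmega_mem_orderLE i k) (fun _ => rfl) ?_
    intro μ hμ
    simp [Jet.proj, hμ, hμ.trans h]
  have hik' : w i k ≠ 0 := by rw [hproj] at hik; exact hik
  have H : ∀ p, pfH w p = 0 := fun p => by
    rw [hw_def, ← eval_tedH]; exact hj p [] (by simp)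
  have hcoord : ∀ μ : (Fin 5 ⊕ Fin 5) →₀ ℕ, 2 + r < μ.degree → j.coord (Sum.inr μ) = 0 := by
    intro μ hμ; simp [Jet.coord, hμ.not_ge]
  choose lst hlst using exists_listIndex_eq (ι := Fin 5 ⊕ Fin 5)
  have hlst_perm : ∀ l, (lst (listIndex l)).Perm l := fun l => perm_of_listIndex_eq (hlst _)
  -- The right-hand sides, as functionals supported in degree `r + 1`.
  let G : Fin 5 → MvPolynomial (Fin 5 ⊕ Fin 5) 𝕜 →ₗ[𝕜] 𝕜 := fun p =>
    (MvPolynomial.basisMonomials (Fin 5 ⊕ Fin 5) 𝕜).constr 𝕜 fun ν =>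
      if ν.degree = r + 1 then -j.eval (totalDerivs (lst ν) (tedH 𝕜 p)) else 0
  have hGm : ∀ p ν, G p (MvPolynomial.monomial ν 1) =
      if ν.degree = r + 1 then -j.eval (totalDerivs (lst ν) (tedH 𝕜 p)) else 0 := by
    intro p ν
    have := (MvPolynomial.basisMonomials (Fin 5 ⊕ Fin 5) 𝕜).constr_basis 𝕜 (fun ν =>
      if ν.degree = r + 1 then -j.eval (totalDerivs (lst ν) (tedH 𝕜 p)) else 0) ν
    rwa [MvPolynomial.coe_basisMonomials] at this
  -- The compatibility conditions that come from an identity `∑ D_{s p} Hᵖ = 0`.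
  have hcompat : ∀ s : Fin 5 → Fin 5 ⊕ Fin 5, ∑ p, totalDeriv 𝕜 (s p) (tedH 𝕜 p) = 0 →
      ∀ f, ∑ p, G p (f * MvPolynomial.X (s p)) = 0 := by
    intro s hs f
    have : ∑ p, G p ∘ₗ LinearMap.mulRight 𝕜 (MvPolynomial.X (s p)) = 0 := by
      apply (MvPolynomial.basisMonomials (Fin 5 ⊕ Fin 5) 𝕜).ext
      intro ν
      simp only [MvPolynomial.coe_basisMonomials, LinearMap.sum_apply, LinearMap.comp_apply,
        LinearMap.mulRight_apply, LinearMap.zero_apply, MvPolynomial.X, MvPolynomial.monomial_mul,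
        mul_one, hGm]
      by_cases hν : ν.degree = r
      · have h1 : ∀ p, totalDerivs (lst (ν + Finsupp.single (s p) 1)) (tedH 𝕜 p) =
            totalDerivs (lst ν) (totalDeriv 𝕜 (s p) (tedH 𝕜 p)) := by
          intro p
          have h2 : (lst (ν + Finsupp.single (s p) 1)).Perm (lst ν ++ [s p]) := by
            apply perm_of_listIndex_eq
            rw [hlst, listIndex_append_singleton, hlst]
          rw [totalDerivs_perm h2, totalDerivs_append]
          rfl
        simp only [map_add, hν, Finsupp.degree_single, if_true, h1]
        rw [Finset.sum_neg_distrib]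
        simp only [Jet.eval_eq]
        rw [← map_sum, ← totalDerivs_sum, hs, totalDerivs_zero, map_zero, neg_zero]
      · simp [hν]
    have := LinearMap.congr_fun this f
    simpa using this
  -- The compatibility conditions that come from `∑ₖ ω_{ik} Hᵏ = 0`: in its total derivatives all
  -- terms vanish that contain `Hᵏ` in order at most `r`.
  have hG : ∀ i, ∑ k, w i k • G k = 0 := by
    intro i
    apply (MvPolynomial.basisMonomials (Fin 5 ⊕ Fin 5) 𝕜).ext
    intro ν
    simp only [MvPolynomial.coe_basisMonomials, LinearMap.sum_apply, LinearMap.smul_apply,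
      LinearMap.zero_apply, hGm, smul_eq_mul]
    by_cases hν : ν.degree = r + 1
    · simp only [hν, if_true, mul_neg, Finset.sum_neg_distrib, neg_eq_zero]
      have h1 : ∀ k, w i k * j.eval (totalDerivs (lst ν) (tedH 𝕜 k)) =
          j.eval (totalDerivs (lst ν) (tedOmega 𝕜 i k * tedH 𝕜 k)) := by
        intro k
        have h2 := totalDerivs_mul_sub_mem_span (tedOmega 𝕜 i k) (tedH 𝕜 k) (lst ν)
        have h3 : Ideal.span {F | ∃ l' : List (Fin 5 ⊕ Fin 5), l'.length < (lst ν).length ∧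
            F = totalDerivs l' (tedH 𝕜 k)} ≤ RingHom.ker (MvPolynomial.eval j.coord) := by
          rw [Ideal.span_le]
          rintro _ ⟨l', hl', rfl⟩
          rw [← degree_listIndex (lst ν), hlst, hν] at hl'
          exact hj k l' (by omega)
        have h4 := h3 h2
        rw [RingHom.mem_ker, map_sub, map_mul, sub_eq_zero] at h4
        exact h4.symm
      simp only [h1]
      simp only [Jet.eval_eq]
      rw [← map_sum, ← totalDerivs_sum, tedH_eq, sum_mul_pfH isSkew_tedOmega, totalDerivs_zero,
        map_zero]
    · simp [hν]
  obtain ⟨L, hL⟩ := exists_functional hw hik' H G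
    (hcompat Sum.inl sum_totalDeriv_inl_tedH) (hcompat Sum.inr sum_totalDeriv_inr_tedH) hG
  let j' : Jet 𝕜 (Fin 5 ⊕ Fin 5) (2 + (r + 1)) :=
    (j.1, fun μ => if h : μ.1.degree ≤ 2 + r then j.2 ⟨μ.1, h⟩ else L (MvPolynomial.monomial μ.1 1))
  have hlow : ∀ F ∈ orderLE 𝕜 (Fin 5 ⊕ Fin 5) (2 + r), j'.eval F = j.eval F := by
    intro F hF
    refine MvPolynomial.eval_congr_of_mem_orderLE hF (fun _ => rfl) fun μ hμ => ?_
    have : μ.degree ≤ 2 + (r + 1) := by omega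
    simp [j', hμ, this]
  have homega : omegaAt j' = w := by
    funext i k
    exact hlow _ (orderLE_mono (by omega) (tedOmega_mem_orderLE i k))
  refine ⟨j', ⟨⟨i, k, ?_⟩, fun p l hl => ?_⟩, ?_⟩
  · rw [hproj, homega]; exact hik'
  · rcases Nat.lt_or_ge r l.length with hlt | hle
    · have hlen : l.length = r + 1 := le_antisymm hl hlt
      have hne : l ≠ [] := by rintro rfl; simp at hlen
      have hrem := totalDerivs_pfH_sub_mem_orderLE (tedOmega_mem_orderLE (𝕜 := 𝕜)) l hne p
      rw [hlen, show 1 + (r + 1) = 2 + r by omega, ← tedH_eq] at hrem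
      have hrem' := hlow _ hrem
      simp only [Jet.eval_eq, map_sub, ringHom_polarH] at hrem'
      -- The part of top order vanishes at `j`, and at `j'` it is given by `L`.
      have e1 : (fun i k => MvPolynomial.eval j.coord (totalDerivs l (tedOmega 𝕜 i k))) = 0 := by
        funext i k
        simp only [tedOmega_eq, totalDerivs_sub, totalDerivs_X_inr, map_sub, MvPolynomial.eval_X]
        rw [hcoord, hcoord, sub_zero]; rfl
        all_goals simp only [map_add, degree_xy, degree_listIndex, hlen]; omega
      have e2 : (fun i k => MvPolynomial.eval j'.coord (totalDerivs l (tedOmega 𝕜 i k))) =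
          fun i k => (L ∘ₗ LinearMap.mulLeft 𝕜 (MvPolynomial.monomial (listIndex l) 1))
            (symbolOmega 𝕜 i k) := by
        funext i k
        have h1 : ∀ a b, j'.coord (Sum.inr (xy a b + listIndex l)) =
            L (MvPolynomial.monomial (xy a b + listIndex l) 1) := by
          intro a b
          have hd : (xy a b + listIndex l).degree = 2 + (r + 1) := by
            rw [map_add, degree_xy, degree_listIndex, hlen]
          simp [Jet.coord, j', degree_xy, degree_listIndex, hlen]
        simp only [tedOmega_eq, totalDerivs_sub, totalDerivs_X_inr, map_sub, MvPolynomial.eval_X,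
          h1]
        simp only [symbolOmega, LinearMap.comp_apply, LinearMap.mulLeft_apply, MvPolynomial.X,
          map_sub, MvPolynomial.monomial_mul, mul_one, xy, add_comm (listIndex l)]
      have e3 : (fun i k => MvPolynomial.eval j'.coord (tedOmega 𝕜 i k)) = w := homega
      have e4 : polarH (fun i k => MvPolynomial.eval j.coord (tedOmega 𝕜 i k))
          (0 : Fin 5 → Fin 5 → 𝕜) p = 0 := by
        fin_cases p <;> simp [polarH, pfPolar]
      rw [e1, e2, e3, e4, sub_zero, ← map_polarH, LinearMap.comp_apply, LinearMap.mulLeft_apply,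
        hL, hGm, degree_listIndex, hlen, if_pos rfl, totalDerivs_perm (hlst_perm l)] at hrem'
      rw [Jet.eval_eq] at hrem' ⊢
      linear_combination hrem'
    · rw [hlow, hj p l hle]
      exact orderLE_mono (by omega) (totalDerivs_mem_orderLE l (tedH_mem_orderLE p))
  · refine Prod.ext rfl (funext fun μ => ?_)
    simp [Jet.proj, j', μ.2]

end Extension

/-! ### Linear functionals on the homogeneous parts of a quotient of a polynomial ring -/

section DualPart

variable {K σ : Type*} [Field K]

open MvPolynomial

/-- The dual of the part of degree `n` of the quotient by a homogeneous ideal `I`, as a space of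
functionals on the polynomial ring. -/
def dualPart (n : ℕ) (I : Ideal (MvPolynomial σ K)) :
    Submodule K (MvPolynomial σ K →ₗ[K] K) where
  carrier := {L | (∀ κ : σ →₀ ℕ, κ.degree ≠ n → L (monomial κ 1) = 0) ∧ ∀ f ∈ I, L f = 0}
  add_mem' := by
    rintro L L' ⟨h1, h2⟩ ⟨h1', h2'⟩
    exact ⟨fun κ hκ => by simp [h1 κ hκ, h1' κ hκ], fun f hf => by simp [h2 f hf, h2' f hf]⟩
  zero_mem' := by simp
  smul_mem' := by
    rintro t L ⟨h1, h2⟩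
    exact ⟨fun κ hκ => by simp [h1 κ hκ], fun f hf => by simp [h2 f hf]⟩

theorem mem_dualPart {n : ℕ} {I : Ideal (MvPolynomial σ K)} {L : MvPolynomial σ K →ₗ[K] K} :
    L ∈ dualPart n I ↔
      (∀ κ : σ →₀ ℕ, κ.degree ≠ n → L (monomial κ 1) = 0) ∧ ∀ f ∈ I, L f = 0 :=
  Iff.rfl

theorem forall_mem_span_apply_eq_zero_iff {Q : Set (MvPolynomial σ K)}
    {L : MvPolynomial σ K →ₗ[K] K} :
    (∀ f ∈ Ideal.span Q, L f = 0) ↔ ∀ g ∈ Q, ∀ ν, L (monomial ν 1 * g) = 0 := by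
  refine ⟨fun h g hg ν => h _ (Ideal.mul_mem_left _ _ (Ideal.subset_span hg)), fun h f hf => ?_⟩
  have key : ∀ h, L (h * f) = 0 := by
    induction hf using Submodule.span_induction with
    | mem g hg =>
      intro f
      have : L ∘ₗ LinearMap.mulRight K g = 0 := by
        apply (basisMonomials σ K).ext
        intro ν
        simpa using h g hg ν
      simpa using LinearMap.congr_fun this f
    | zero => simp
    | add x y _ _ hx hy => intro h; rw [mul_add, map_add, hx, hy, add_zero]
    | smul a x _ hx => intro h; rw [smul_eq_mul, ← mul_assoc]; exact hx _
  simpa using key 1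

theorem apply_eq_zero_of_isHomogeneous {n d : ℕ} {L : MvPolynomial σ K →ₗ[K] K}
    (hL : ∀ κ : σ →₀ ℕ, κ.degree ≠ n → L (monomial κ 1) = 0) (hd : d ≠ n)
    {f : MvPolynomial σ K} (hf : f.IsHomogeneous d) : L f = 0 := by
  rw [f.as_sum, map_sum]
  refine Finset.sum_eq_zero fun κ hκ => ?_
  have h1 : κ.degree = d := by
    have := hf (mem_support_iff.1 hκ)
    exact (DFunLike.congr_fun Finsupp.degree_eq_weight_one κ).trans this
  rw [← mul_one (coeff κ f), ← smul_eq_mul, ← smul_monomial, map_smul, hL κ (h1 ▸ hd), smul_zero]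

/-- Dimension count with a set `T` of standard monomials: the remaining monomials of degree `n`
are the leading terms of elements `f κ` that span the part of degree `n` of `I`. -/
theorem finrank_dualPart_eq [Fintype σ] [DecidableEq σ] (n : ℕ) (I : Ideal (MvPolynomial σ K))
    (T : Finset (σ →₀ ℕ)) (f : (σ →₀ ℕ) → MvPolynomial σ K)
    (hT : ∀ κ ∈ T, κ.degree = n) (hf : ∀ κ, κ ∉ T → κ.degree = n → f κ ∈ I)
    (hI : ∀ L : MvPolynomial σ K →ₗ[K] K,
      (∀ κ : σ →₀ ℕ, κ.degree ≠ n → L (monomial κ 1) = 0) →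
      (∀ κ, κ ∉ T → κ.degree = n → L (f κ) = 0) → ∀ g ∈ I, L g = 0)
    (hinj : ∀ L : MvPolynomial σ K →ₗ[K] K,
      (∀ κ : σ →₀ ℕ, κ.degree ≠ n → L (monomial κ 1) = 0) →
      (∀ κ, κ ∉ T → κ.degree = n → L (f κ) = 0) → (∀ κ ∈ T, L (monomial κ 1) = 0) →
      ∀ κ : σ →₀ ℕ, κ.degree = n → L (monomial κ 1) = 0) :
    Module.finrank K (dualPart n I) = T.card := by
  classical
  let A := {κ : σ →₀ ℕ // κ ∈ Finset.univ.finsuppAntidiag n}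
  have : Finite A := Finite.of_fintype {κ : σ →₀ ℕ // κ ∈ Finset.univ.finsuppAntidiag n}
  have hA : ∀ κ : σ →₀ ℕ, κ ∈ Finset.univ.finsuppAntidiag n ↔ κ.degree = n := fun κ => by
    simp [Finset.mem_finsuppAntidiag, Finsupp.degree_eq_sum]
  let ext : (A → K) →ₗ[K] (MvPolynomial σ K →ₗ[K] K) :=
    ((basisMonomials σ K).constr K).toLinearMap ∘ₗ
      Function.ExtendByZero.linearMap K (Subtype.val : A → (σ →₀ ℕ))
  have hext1 : ∀ v (κ : A), ext v (monomial κ.1 1) = v κ := by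
    intro v κ
    have := (basisMonomials σ K).constr_basis K (Function.extend Subtype.val v 0) κ.1
    rw [coe_basisMonomials] at this
    exact this.trans (Subtype.val_injective.extend_apply _ _ _)
  have hext2 : ∀ v κ, κ.degree ≠ n → ext v (monomial κ 1) = 0 := by
    intro v κ hκ
    have := (basisMonomials σ K).constr_basis K (Function.extend Subtype.val v 0) κ
    rw [coe_basisMonomials] at this
    refine this.trans (Function.extend_apply' _ _ _ ?_)
    rintro ⟨a, rfl⟩
    exact hκ ((hA _).1 a.2)
  let Φ : (A → K) →ₗ[K] (A → K) := LinearMap.pi fun κ =>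
    if κ.1 ∈ T then LinearMap.proj κ else (LinearMap.applyₗ (f κ.1)) ∘ₗ ext
  have hΦ1 : ∀ v (κ : A), κ.1 ∈ T → Φ v κ = v κ := fun v κ h => by simp [Φ, h]
  have hΦ2 : ∀ v (κ : A), κ.1 ∉ T → Φ v κ = ext v (f κ.1) := fun v κ h => by simp [Φ, h]
  have hΦinj : Function.Injective Φ := by
    rw [← LinearMap.ker_eq_bot, LinearMap.ker_eq_bot']
    intro v hv
    funext κ
    rw [← hext1 v κ]
    refine hinj (ext v) (hext2 v) (fun κ h1 h2 => ?_) (fun κ h => ?_) κ ((hA _).1 κ.2)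
    · rw [← hΦ2 v ⟨κ, (hA κ).2 h2⟩ h1, hv]; rfl
    · rw [hext1 v ⟨κ, (hA κ).2 (hT κ h)⟩, ← hΦ1 v ⟨κ, (hA κ).2 (hT κ h)⟩ h, hv]; rfl
  have hΦsurj : Function.Surjective Φ := LinearMap.injective_iff_surjective.1 hΦinj
  let R : dualPart n I →ₗ[K] (T → K) := LinearMap.pi fun κ =>
    (LinearMap.applyₗ (monomial κ.1 1)) ∘ₗ (dualPart n I).subtype
  have hR : ∀ L κ, R L κ = L.1 (monomial κ.1 1) := fun L κ => rfl
  have hRbij : Function.Bijective R := by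
    constructor
    · rw [injective_iff_map_eq_zero]
      intro L hL
      apply Subtype.ext
      apply (basisMonomials σ K).ext
      intro κ
      rw [coe_basisMonomials]
      by_cases hκ : κ.degree = n
      · exact hinj L.1 L.2.1 (fun κ h1 h2 => L.2.2 _ (hf κ h1 h2))
          (fun κ h => congrFun hL ⟨κ, h⟩) κ hκ
      · exact L.2.1 κ hκ
    · intro t
      obtain ⟨v, hv⟩ := hΦsurj fun κ => if h : κ.1 ∈ T then t ⟨κ.1, h⟩ else 0
      refine ⟨⟨ext v, hext2 v, hI _ (hext2 v) fun κ h1 h2 => ?_⟩, ?_⟩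
      · rw [← hΦ2 v ⟨κ, (hA κ).2 h2⟩ h1, hv]; simp [h1]
      · funext κ
        have h := (hA _).2 (hT κ.1 κ.2)
        rw [hR]
        change ext v (monomial κ.1 1) = _
        rw [hext1 v ⟨κ.1, h⟩, ← hΦ1 v ⟨κ.1, h⟩ κ.2, hv]
        simp
  rw [(LinearEquiv.ofBijective R hRbij).finrank_eq, Module.finrank_fintype_fun_eq_card,
    Fintype.card_coe]

theorem isHomogeneous_linForm {ι : Type*} [Fintype ι] (w : ι → K) :
    (linForm w).IsHomogeneous 1 := by
  rw [linForm_apply]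
  exact IsHomogeneous.sum _ _ _ fun i _ => by
    rw [smul_eq_C_mul]; simpa using (isHomogeneous_C ι (w i)).mul (isHomogeneous_X K i)

theorem isHomogeneous_linSubst {ι : Type*} [Fintype σ] [Fintype ι]
    (b : Module.Basis σ K (ι → K)) {f : MvPolynomial σ K} {d : ℕ} (hf : f.IsHomogeneous d) :
    (linSubst b f).IsHomogeneous d := by
  have := hf.aeval (fun m => linForm (b m)) fun m => isHomogeneous_linForm (b m)
  rw [one_mul] at this
  exact this

theorem isHomogeneous_linSubst_symm {ι : Type*} [Fintype σ] [Fintype ι]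
    (b : Module.Basis σ K (ι → K)) {f : MvPolynomial ι K} {d : ℕ} (hf : f.IsHomogeneous d) :
    ((linSubst b).symm f).IsHomogeneous d := by
  classical
  have := hf.aeval (fun i => linForm (b.equivFun (Pi.single i 1))) fun m => isHomogeneous_linForm _
  rw [one_mul] at this
  exact this

/-- A linear change of variables identifies the dual spaces. -/
theorem finrank_dualPart_map {ι : Type*} [Fintype σ] [Fintype ι] (n : ℕ)
    (b : Module.Basis σ K (ι → K)) (I : Ideal (MvPolynomial σ K)) :
    Module.finrank K (dualPart n (I.map (linSubst b : MvPolynomial σ K →+* MvPolynomial ι K))) =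
      Module.finrank K (dualPart n I) := by
  classical
  have h : dualPart n (I.map (linSubst b : MvPolynomial σ K →+* MvPolynomial ι K)) =
      (dualPart n I).comap ((linSubst b).toLinearEquiv.dualMap :
        Module.Dual K (MvPolynomial ι K) →ₗ[K] Module.Dual K (MvPolynomial σ K)) := by
    ext L
    rw [Submodule.mem_comap, mem_dualPart, mem_dualPart]
    refine and_congr ⟨fun h κ hκ => ?_, fun h κ hκ => ?_⟩ ⟨fun h f hf => ?_, fun h f hf => ?_⟩
    · exact apply_eq_zero_of_isHomogeneous h hκ (isHomogeneous_linSubst b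
        (isHomogeneous_monomial 1 rfl))
    · have := apply_eq_zero_of_isHomogeneous h hκ (isHomogeneous_linSubst_symm b
        (isHomogeneous_monomial (1 : K) (rfl : κ.degree = κ.degree)))
      simpa using this
    · exact h _ (Ideal.mem_map_of_mem _ hf)
    · obtain ⟨g, hg, rfl⟩ := (Ideal.mem_map_iff_of_surjective
        (linSubst b : MvPolynomial σ K →+* MvPolynomial ι K) (linSubst b).surjective).1 hf
      exact h g hg
  rw [h]
  exact ((linSubst b).toLinearEquiv.dualMap.ofSubmodule' _).finrank_eq

end DualPart

/-! ### The symbol in quasi-regular coordinates -/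

section NormalForm

open MvPolynomial

/-- The first of the three quadrics generating the ideal of the symbol in quasi-regular coordinates,
with leading term `X₈²`. -/
def quadric88 (K : Type*) [CommRing K] : MvPolynomial (Fin 10) K :=
  X 8 * X 8 + X 6 * X 8 - X 5 * X 7 - X 5 * X 9

/-- The second of the quadrics, with leading term `X₈X₉`. -/
def quadric89 (K : Type*) [CommRing K] : MvPolynomial (Fin 10) K :=
  X 8 * X 9 + X 6 * X 9 - X 4 * X 5

/-- The third of the quadrics, with leading term `X₉²`. -/
def quadric99 (K : Type*) [CommRing K] : MvPolynomial (Fin 10) K :=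
  X 9 * X 9 + X 7 * X 9 - X 4 * X 8

/-- The ideal of the symbol together with the first `k` coordinates. -/
def normalIdeal (K : Type*) [CommRing K] (k : ℕ) : Ideal (MvPolynomial (Fin 10) K) :=
  Ideal.span ({quadric88 K, quadric89 K, quadric99 K} ∪ X '' {m | (m : ℕ) < k})

/-- The exponents of degree `n` of the monomials in the last `10 - k` coordinates that are not
divisible by `X₈²`, `X₈X₉` or `X₉²`. -/
def standardExponents (n k : ℕ) : Finset (Fin 10 →₀ ℕ) :=
  (Finset.univ.finsuppAntidiag n).filter fun κ =>
    (∀ m : Fin 10, (m : ℕ) < k → κ m = 0) ∧ κ 8 + κ 9 ≤ 1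

theorem mem_standardExponents {n k : ℕ} {κ : Fin 10 →₀ ℕ} :
    κ ∈ standardExponents n k ↔
      κ.degree = n ∧ (∀ m : Fin 10, (m : ℕ) < k → κ m = 0) ∧ κ 8 + κ 9 ≤ 1 := by
  simp [standardExponents, Finset.mem_finsuppAntidiag, Finsupp.degree_eq_sum]

open Classical in
/-- The element of `normalIdeal K k` with leading exponent `κ`, for nonstandard `κ`. Where several
generators could be used, the choice is such that the multipliers of `quadric89` and `quadric99`
do not contain `X₈`. -/
def leadElement (K : Type*) [CommRing K] (k : ℕ) (κ : Fin 10 →₀ ℕ) : MvPolynomial (Fin 10) K :=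
  if ∃ m : Fin 10, (m : ℕ) < k ∧ κ m ≠ 0 then monomial κ 1
  else if 2 ≤ κ 8 then monomial (κ - (Finsupp.single 8 1 + Finsupp.single 8 1)) 1 * quadric88 K
  else if κ 8 = 1 then monomial (κ - (Finsupp.single 8 1 + Finsupp.single 9 1)) 1 * quadric89 K
  else monomial (κ - (Finsupp.single 9 1 + Finsupp.single 9 1)) 1 * quadric99 K

variable {K : Type*} [Field K]

theorem leadElement_mem (k : ℕ) (κ : Fin 10 →₀ ℕ) : leadElement K k κ ∈ normalIdeal K k := by
  unfold leadElement
  split_ifs with h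
  · obtain ⟨m, hm, hκ⟩ := h
    have : (monomial κ 1 : MvPolynomial (Fin 10) K) =
        monomial (κ - Finsupp.single m 1) 1 * X m := by
      rw [X, monomial_mul, one_mul, tsub_add_cancel_of_le]
      simpa [Finsupp.single_le_iff] using Nat.one_le_iff_ne_zero.2 hκ
    rw [this]
    exact Ideal.mul_mem_left _ _ (Ideal.subset_span (Or.inr ⟨m, hm, rfl⟩))
  all_goals exact Ideal.mul_mem_left _ _ (Ideal.subset_span (by simp))

section Functional

variable (L : MvPolynomial (Fin 10) K →ₗ[K] K) (ν : Fin 10 →₀ ℕ)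

theorem apply_monomial_mul_quadric88 : L (monomial ν 1 * quadric88 K) =
    L (monomial (ν + (Finsupp.single 8 1 + Finsupp.single 8 1)) 1) +
      L (monomial (ν + (Finsupp.single 6 1 + Finsupp.single 8 1)) 1) -
      L (monomial (ν + (Finsupp.single 5 1 + Finsupp.single 7 1)) 1) -
      L (monomial (ν + (Finsupp.single 5 1 + Finsupp.single 9 1)) 1) := by
  simp only [quadric88, mul_add, mul_sub, map_add, map_sub, X, monomial_mul, mul_one]

theorem apply_monomial_mul_quadric89 : L (monomial ν 1 * quadric89 K) =
    L (monomial (ν + (Finsupp.single 8 1 + Finsupp.single 9 1)) 1) +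
      L (monomial (ν + (Finsupp.single 6 1 + Finsupp.single 9 1)) 1) -
      L (monomial (ν + (Finsupp.single 4 1 + Finsupp.single 5 1)) 1) := by
  simp only [quadric89, mul_add, mul_sub, map_add, map_sub, X, monomial_mul, mul_one]

theorem apply_monomial_mul_quadric99 : L (monomial ν 1 * quadric99 K) =
    L (monomial (ν + (Finsupp.single 9 1 + Finsupp.single 9 1)) 1) +
      L (monomial (ν + (Finsupp.single 7 1 + Finsupp.single 9 1)) 1) -
      L (monomial (ν + (Finsupp.single 4 1 + Finsupp.single 8 1)) 1) := by
  simp only [quadric99, mul_add, mul_sub, map_add, map_sub, X, monomial_mul, mul_one]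

variable {L}

theorem two_le_of_not_mem_standardExponents {n k : ℕ} {κ : Fin 10 →₀ ℕ} (hκ : κ.degree = n)
    (h : κ ∉ standardExponents n k) (hk : ¬∃ m : Fin 10, (m : ℕ) < k ∧ κ m ≠ 0) :
    2 ≤ κ 8 + κ 9 := by
  by_contra hlt
  push Not at hk hlt
  exact h (mem_standardExponents.2 ⟨hκ, hk, by omega⟩)

/-- A functional that vanishes on the elements `leadElement` and on the standard monomials
vanishes: reduction of a nonstandard monomial lowers its degree in the last two variables. -/
theorem apply_monomial_eq_zero_of_leadElement {n k : ℕ}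
    (hL : ∀ κ : Fin 10 →₀ ℕ, κ.degree ≠ n → L (monomial κ 1) = 0)
    (hlead : ∀ κ, κ ∉ standardExponents n k → κ.degree = n → L (leadElement K k κ) = 0)
    (hstd : ∀ κ ∈ standardExponents n k, L (monomial κ 1) = 0) (κ : Fin 10 →₀ ℕ) :
    L (monomial κ 1) = 0 := by
  induction hc : κ 8 + κ 9 using Nat.strong_induction_on generalizing κ with
  | _ c ih =>
  by_cases hκ : κ.degree = n
  swap
  · exact hL κ hκ
  by_cases hs : κ ∈ standardExponents n k
  · exact hstd κ hs
  have h := hlead κ hs hκ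
  unfold leadElement at h
  split_ifs at h with h1 h2 h3
  · exact h
  · obtain ⟨ν, rfl⟩ : ∃ ν, κ = ν + (Finsupp.single 8 1 + Finsupp.single 8 1) := by
      refine ⟨κ - (Finsupp.single 8 1 + Finsupp.single 8 1), (tsub_add_cancel_of_le ?_).symm⟩
      intro m
      simp only [Finsupp.add_apply, Finsupp.single_apply]
      split_ifs with hm
      · subst hm; omega
      · omega
    rw [add_tsub_cancel_right, apply_monomial_mul_quadric88] at h
    rw [ih _ ?_ (ν + (Finsupp.single 6 1 + Finsupp.single 8 1)) rfl,
      ih _ ?_ (ν + (Finsupp.single 5 1 + Finsupp.single 7 1)) rfl,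
      ih _ ?_ (ν + (Finsupp.single 5 1 + Finsupp.single 9 1)) rfl] at h
    · simpa using h
    all_goals
      rw [← hc]; simp
    all_goals omega
  · have h9 := two_le_of_not_mem_standardExponents hκ hs h1
    obtain ⟨ν, rfl⟩ : ∃ ν, κ = ν + (Finsupp.single 8 1 + Finsupp.single 9 1) := by
      refine ⟨κ - (Finsupp.single 8 1 + Finsupp.single 9 1), (tsub_add_cancel_of_le ?_).symm⟩
      intro m
      simp only [Finsupp.add_apply, Finsupp.single_apply]
      split_ifs with hm hm' hm'
      · subst hm; simp at hm'
      · subst hm; omega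
      · subst hm'; omega
      · omega
    rw [add_tsub_cancel_right, apply_monomial_mul_quadric89] at h
    rw [ih _ ?_ (ν + (Finsupp.single 6 1 + Finsupp.single 9 1)) rfl,
      ih _ ?_ (ν + (Finsupp.single 4 1 + Finsupp.single 5 1)) rfl] at h
    · simpa using h
    all_goals
      rw [← hc]; simp
    all_goals omega
  · have h9 := two_le_of_not_mem_standardExponents hκ hs h1
    obtain ⟨ν, rfl⟩ : ∃ ν, κ = ν + (Finsupp.single 9 1 + Finsupp.single 9 1) := by
      refine ⟨κ - (Finsupp.single 9 1 + Finsupp.single 9 1), (tsub_add_cancel_of_le ?_).symm⟩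
      intro m
      simp only [Finsupp.add_apply, Finsupp.single_apply]
      split_ifs with hm
      · subst hm; omega
      · omega
    rw [add_tsub_cancel_right, apply_monomial_mul_quadric99] at h
    rw [ih _ ?_ (ν + (Finsupp.single 7 1 + Finsupp.single 9 1)) rfl,
      ih _ ?_ (ν + (Finsupp.single 4 1 + Finsupp.single 8 1)) rfl] at h
    · simpa using h
    all_goals
      rw [← hc]; simp
    all_goals omega

/-- The elements `leadElement` span the ideal: the multiples of `quadric89` and `quadric99` by
`X₈`, which do not occur among them, are rewritten by means of the two linear syzygies. -/
theorem apply_eq_zero_of_mem_normalIdeal {n k : ℕ} (hk : k ≤ 9)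
    (hL : ∀ κ : Fin 10 →₀ ℕ, κ.degree ≠ n → L (monomial κ 1) = 0)
    (hlead : ∀ κ, κ ∉ standardExponents n k → κ.degree = n → L (leadElement K k κ) = 0) :
    ∀ g ∈ normalIdeal K k, L g = 0 := by
  have hbad : ∀ κ : Fin 10 →₀ ℕ, ∀ m : Fin 10, (m : ℕ) < k → κ m ≠ 0 →
      L (monomial κ 1) = 0 := by
    intro κ m hm hκm
    by_cases hκ : κ.degree = n
    · have h := hlead κ (fun h => hκm ((mem_standardExponents.1 h).2.1 m hm)) hκ
      rwa [leadElement, if_pos ⟨m, hm, hκm⟩] at h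
    · exact hL κ hκ
  have h88 : ∀ ν, L (monomial ν 1 * quadric88 K) = 0 := by
    intro ν
    by_cases hd : (ν + (Finsupp.single 8 1 + Finsupp.single 8 1) : Fin 10 →₀ ℕ).degree = n
    swap
    · rw [apply_monomial_mul_quadric88, hL, hL, hL, hL]
      · simp
      all_goals simpa using hd
    by_cases hb : ∃ m : Fin 10, (m : ℕ) < k ∧
        (ν + (Finsupp.single 8 1 + Finsupp.single 8 1) : Fin 10 →₀ ℕ) m ≠ 0
    · rw [apply_monomial_mul_quadric88]
      by_cases hν : ∃ m : Fin 10, (m : ℕ) < k ∧ ν m ≠ 0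
      · obtain ⟨m, hm, hν⟩ := hν
        rw [hbad _ m hm, hbad _ m hm, hbad _ m hm, hbad _ m hm]
        · simp
        all_goals simp [hν]
      · -- Only the leading term can cause this, with `8 < k`; then no term survives.
        have h8 : 8 < k := by
          obtain ⟨m, hm, hb⟩ := hb
          push Not at hν
          have : m = 8 := by
            by_contra h
            simp [hν m hm, Ne.symm h] at hb
          simpa [this] using hm
        rw [hbad _ 8 (by simpa using h8), hbad _ 8 (by simpa using h8),
          hbad _ 5 (by simp; omega), hbad _ 5 (by simp; omega)]
        · simp
        all_goals simp
    · have h := hlead _ (fun h => by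
        have := (mem_standardExponents.1 h).2.2; simp at this; omega) hd
      rw [leadElement, if_neg hb, if_pos (by simp), add_tsub_cancel_right] at h
      exact h
  -- Induction on the exponent of `X₈` in the multiplier.
  have h8999 : ∀ c, ∀ ν : Fin 10 →₀ ℕ, ν 8 = c →
      L (monomial ν 1 * quadric89 K) = 0 ∧ L (monomial ν 1 * quadric99 K) = 0 := by
    intro c
    induction c with
    | zero =>
      intro ν hν8
      constructor
      · by_cases hd : (ν + (Finsupp.single 8 1 + Finsupp.single 9 1) : Fin 10 →₀ ℕ).degree = n
        swap
        · rw [apply_monomial_mul_quadric89, hL, hL, hL]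
          · simp
          all_goals simpa using hd
        by_cases hb : ∃ m : Fin 10, (m : ℕ) < k ∧
            (ν + (Finsupp.single 8 1 + Finsupp.single 9 1) : Fin 10 →₀ ℕ) m ≠ 0
        · rw [apply_monomial_mul_quadric89]
          by_cases hν : ∃ m : Fin 10, (m : ℕ) < k ∧ ν m ≠ 0
          · obtain ⟨m, hm, hν⟩ := hν
            rw [hbad _ m hm, hbad _ m hm, hbad _ m hm]
            · simp
            all_goals simp [hν]
          · have h8 : 8 < k := by
              obtain ⟨m, hm, hb⟩ := hb
              push Not at hν
              have : m = 8 ∨ m = 9 := by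
                by_contra h
                push Not at h
                simp [hν m hm, Ne.symm h.1, Ne.symm h.2] at hb
              rcases this with rfl | rfl
              · simpa using hm
              · simp at hm; omega
            rw [hbad _ 8 (by simpa using h8), hbad _ 6 (by simp; omega),
              hbad _ 4 (by simp; omega)]
            · simp
            all_goals simp
        · have h := hlead _ (fun h => by
            have := (mem_standardExponents.1 h).2.2; simp at this; omega) hd
          rw [leadElement, if_neg hb, if_neg (by simp [hν8]), if_pos (by simp [hν8]),
            add_tsub_cancel_right] at h
          exact h
      · by_cases hd : (ν + (Finsupp.single 9 1 + Finsupp.single 9 1) : Fin 10 →₀ ℕ).degree = n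
        swap
        · rw [apply_monomial_mul_quadric99, hL, hL, hL]
          · simp
          all_goals simpa using hd
        by_cases hb : ∃ m : Fin 10, (m : ℕ) < k ∧
            (ν + (Finsupp.single 9 1 + Finsupp.single 9 1) : Fin 10 →₀ ℕ) m ≠ 0
        · rw [apply_monomial_mul_quadric99]
          obtain ⟨m, hm, hb⟩ := hb
          have hν : ν m ≠ 0 := by
            intro h
            have : m ≠ 9 := by rintro rfl; simp at hm; omega
            simp [h, Ne.symm this] at hb
          rw [hbad _ m hm, hbad _ m hm, hbad _ m hm]
          · simp
          all_goals simp [hν]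
        · have h := hlead _ (fun h => by
            have := (mem_standardExponents.1 h).2.2; simp at this; omega) hd
          rw [leadElement, if_neg hb, if_neg (by simp [hν8]), if_neg (by simp [hν8]),
            add_tsub_cancel_right] at h
          exact h
    | succ c ih =>
      intro ν hν8
      obtain ⟨ν, rfl⟩ : ∃ ν', ν = ν' + Finsupp.single 8 1 := by
        refine ⟨ν - Finsupp.single 8 1, (tsub_add_cancel_of_le ?_).symm⟩
        rw [Finsupp.single_le_iff]; omega
      have hν8' : ν 8 = c := by simpa using hν8
      have hX : ∀ m : Fin 10, (monomial (ν + Finsupp.single m 1) 1 : MvPolynomial (Fin 10) K) =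
          monomial ν 1 * X m := fun m => by rw [X, monomial_mul, one_mul]
      have i9 := ih (ν + Finsupp.single 9 1) (by simpa using hν8')
      have i5 := ih (ν + Finsupp.single 5 1) (by simpa using hν8')
      have i6 := ih (ν + Finsupp.single 6 1) (by simpa using hν8')
      have i7 := ih (ν + Finsupp.single 7 1) (by simpa using hν8')
      constructor
      · have e : (monomial (ν + Finsupp.single 8 1) 1 * quadric89 K : MvPolynomial (Fin 10) K) =
            monomial (ν + Finsupp.single 9 1) 1 * quadric88 K +
              monomial (ν + Finsupp.single 5 1) 1 * quadric99 K := by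
          simp only [hX, quadric88, quadric89, quadric99]; ring
        rw [e, map_add, h88, i5.2, add_zero]
      · have e : (monomial (ν + Finsupp.single 8 1) 1 * quadric99 K : MvPolynomial (Fin 10) K) =
            monomial (ν + Finsupp.single 9 1) 1 * quadric89 K +
              monomial (ν + Finsupp.single 7 1) 1 * quadric89 K -
              monomial (ν + Finsupp.single 6 1) 1 * quadric99 K -
              monomial (ν + Finsupp.single 4 1) 1 * quadric88 K := by
          simp only [hX, quadric88, quadric89, quadric99]; ring
        rw [e, map_sub, map_sub, map_add, h88, i9.1, i7.1, i6.2]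
        simp
  rw [normalIdeal, forall_mem_span_apply_eq_zero_iff]
  rintro g (hg | ⟨m, hm, rfl⟩) ν
  · simp only [Set.mem_insert_iff, Set.mem_singleton_iff] at hg
    rcases hg with rfl | rfl | rfl
    · exact h88 ν
    · exact (h8999 _ ν rfl).1
    · exact (h8999 _ ν rfl).2
  · rw [X, monomial_mul, one_mul]
    exact hbad _ m hm (by simp)

end Functional

theorem finrank_dualPart_normalIdeal (n : ℕ) {k : ℕ} (hk : k ≤ 9) :
    Module.finrank K (dualPart n (normalIdeal K k)) = (standardExponents n k).card :=
  finrank_dualPart_eq n _ _ (leadElement K k) (fun _ h => (mem_standardExponents.1 h).1)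
    (fun κ _ _ => leadElement_mem k κ)
    (fun _ hL hlead => apply_eq_zero_of_mem_normalIdeal hk hL hlead)
    (fun _ hL hlead hstd κ _ => apply_monomial_eq_zero_of_leadElement hL hlead hstd κ)

/-- Cartan's count: a standard monomial of degree three arises in exactly one way from one of
degree two by multiplication with a variable not exceeding those that occur in it. -/
theorem card_standardExponents_three :
    (standardExponents 3 0).card = ∑ k : Fin 10, (standardExponents 2 k).card := by
  classical
  rw [← Finset.card_sigma]
  symm
  have hempty : ∀ k : Fin 10, 8 ≤ (k : ℕ) → standardExponents 2 k = ∅ := by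
    intro k hk
    refine Finset.eq_empty_of_forall_notMem fun κ hκ => ?_
    obtain ⟨h1, h2, h3⟩ := mem_standardExponents.1 hκ
    rw [Finsupp.degree_eq_sum, Fin.sum_univ_castSucc, Fin.sum_univ_castSucc,
      Finset.sum_eq_zero] at h1
    · change 0 + κ 8 + κ 9 = 2 at h1; omega
    · intro m _
      exact h2 _ (by simp; omega)
  refine Finset.card_bij (fun z _ => z.2 + Finsupp.single z.1 1) ?_ ?_ ?_
  · rintro ⟨k, κ⟩ h
    simp only [Finset.mem_sigma, Finset.mem_univ, true_and] at h
    have hk : (k : ℕ) < 8 := by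
      by_contra hk
      rw [hempty k (by omega)] at h; simp at h
    obtain ⟨h1, h2, h3⟩ := mem_standardExponents.1 h
    have h8 : k ≠ 8 := by rintro rfl; simp at hk
    have h9 : k ≠ 9 := by rintro rfl; simp at hk
    refine mem_standardExponents.2 ⟨by simp [h1], by simp, ?_⟩
    simpa [Finsupp.single_apply, h8, h9] using h3
  · rintro ⟨k, κ⟩ h ⟨k', κ'⟩ h' he
    simp only [Finset.mem_sigma, Finset.mem_univ, true_and] at h h' he
    have h2 := (mem_standardExponents.1 h).2.1
    have h2' := (mem_standardExponents.1 h').2.1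
    have hkk : k = k' := by
      rcases lt_trichotomy k k' with hlt | heq | hlt
      · have := DFunLike.congr_fun he k
        simp [h2' k hlt, hlt.ne'] at this
      · exact heq
      · have := DFunLike.congr_fun he k'
        simp [h2 k' hlt, hlt.ne'] at this
    subst hkk
    rw [add_right_cancel he]
  · intro κ hκ
    obtain ⟨h1, -, h3⟩ := mem_standardExponents.1 hκ
    have hne : κ.support.Nonempty := by
      rw [Finsupp.support_nonempty_iff]; rintro rfl; simp at h1
    obtain ⟨k, hkm, hmin⟩ : ∃ k, κ k ≠ 0 ∧ ∀ m, κ m ≠ 0 → k ≤ m :=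
      ⟨κ.support.min' hne, Finsupp.mem_support_iff.1 (κ.support.min'_mem hne),
        fun m hm => Finset.min'_le _ _ (Finsupp.mem_support_iff.2 hm)⟩
    obtain ⟨ν, rfl⟩ : ∃ ν, κ = ν + Finsupp.single k 1 := by
      refine ⟨κ - Finsupp.single k 1, (tsub_add_cancel_of_le ?_).symm⟩
      rw [Finsupp.single_le_iff]; omega
    refine ⟨⟨k, ν⟩, ?_, rfl⟩
    simp only [Finset.mem_sigma, Finset.mem_univ, true_and]
    refine mem_standardExponents.2 ⟨by simpa using h1, fun m hm => ?_, ?_⟩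
    · by_contra hνm
      exact absurd hm (not_lt.2 (hmin m (by simp [hνm])))
    · simp only [Finsupp.add_apply] at h3; omega

end NormalForm

/-! ### Cartan's test -/

section CartanTest

open MvPolynomial

variable {K : Type*} [Field K]

/-- The vectors of a quasi-regular basis for the symbol at `ω = e₀ ∧ e₁`. The four variables with
index `0` or `1` do not occur in the minors. Modulo all but the last two vectors the `2 × 3` matrix
becomes `(s, t, 0; 0, s, t)`, with the minors `s²`, `st`, `t²`. -/
def regularVec (K : Type*) [Field K] : Fin 10 → (Fin 5 ⊕ Fin 5 → K) :=
  let x (p : Fin 5) : Fin 5 ⊕ Fin 5 → K := Pi.single (Sum.inl p) 1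
  let y (p : Fin 5) : Fin 5 ⊕ Fin 5 → K := Pi.single (Sum.inr p) 1
  ![x 0, x 1, y 0, y 1, x 4, y 2, x 2 - y 3, x 3 - y 4, y 3, y 4]

theorem linearIndependent_regularVec : LinearIndependent K (regularVec K) := by
  rw [Fintype.linearIndependent_iff]
  intro g hg
  have hx := fun p => congrFun hg (Sum.inl p)
  have hy := fun p => congrFun hg (Sum.inr p)
  simp only [regularVec, Fin.sum_univ_succ] at hx hy
  have x0 := hx 0
  have x1 := hx 1
  have x2 := hx 2
  have x3 := hx 3
  have x4 := hx 4
  have y0 := hy 0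
  have y1 := hy 1
  have y2 := hy 2
  have y3 := hy 3
  have y4 := hy 4
  simp at x0 x1 x2 x3 x4 y0 y1 y2 y3 y4
  have y3' : g 8 = 0 := by simpa [x2] using y3
  have y4' : g 9 = 0 := by simpa [x3] using y4
  intro i; fin_cases i <;> assumption

/-- A quasi-regular basis for the symbol at a decomposable `w` with `w 0 1 ≠ 0` (after the
renumbering `σ`). -/
def regularBasis (w : Fin 5 → Fin 5 → K) (σ : Equiv.Perm (Fin 5)) :
    Module.Basis (Fin 10) K (Fin 5 ⊕ Fin 5 → K) :=
  (basisOfLinearIndependentOfCardEqFinrank (linearIndependent_regularVec (K := K)) (by simp)).map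
    (adaptedBasis w σ).equivFun.symm

theorem linSubst_regularBasis_X (w : Fin 5 → Fin 5 → K) (σ : Equiv.Perm (Fin 5)) (m : Fin 10) :
    linSubst (regularBasis w σ) (X m) =
      linSubst (adaptedBasis w σ) (linForm (regularVec K m)) := by
  rw [linSubst_X, regularBasis, Module.Basis.map_apply, Module.Basis.equivFun_symm_apply,
    ← aeval_linForm]
  simp [linSubst]

/-- The quadrics in the quasi-regular coordinates are the minors that occur in the symbol. -/
theorem linSubst_regularBasis_quadric (w : Fin 5 → Fin 5 → K) (σ : Equiv.Perm (Fin 5)) :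
    let ξ := shear w fun q => (X (Sum.inl (σ q)) : MvPolynomial (Fin 5 ⊕ Fin 5) K)
    let η := shear w fun q => (X (Sum.inr (σ q)) : MvPolynomial (Fin 5 ⊕ Fin 5) K)
    linSubst (regularBasis w σ) (quadric88 K) = ξ 2 * η 3 - ξ 3 * η 2 ∧
    linSubst (regularBasis w σ) (quadric89 K) = ξ 2 * η 4 - ξ 4 * η 2 ∧
    linSubst (regularBasis w σ) (quadric99 K) = ξ 3 * η 4 - ξ 4 * η 3 := by
  have h := linSubst_regularBasis_X w σ
  have h4 : linSubst (regularBasis w σ) (X 4) = shear w (fun q => X (Sum.inl (σ q))) 4 := by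
    rw [h, show linForm (regularVec K 4) = X (Sum.inl 4) by simp [regularVec], linSubst_adaptedBasis_inl]; rfl
  have h5 : linSubst (regularBasis w σ) (X 5) = shear w (fun q => X (Sum.inr (σ q))) 2 := by
    rw [h, show linForm (regularVec K 5) = X (Sum.inr 2) by simp [regularVec], linSubst_adaptedBasis_inr]; rfl
  have h6 : linSubst (regularBasis w σ) (X 6) = shear w (fun q => X (Sum.inl (σ q))) 2 -
      shear w (fun q => X (Sum.inr (σ q))) 3 := by
    rw [h, show linForm (regularVec K 6) = X (Sum.inl 2) - X (Sum.inr 3) by simp [regularVec], map_sub,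
      linSubst_adaptedBasis_inl, linSubst_adaptedBasis_inr]; rfl
  have h7 : linSubst (regularBasis w σ) (X 7) = shear w (fun q => X (Sum.inl (σ q))) 3 -
      shear w (fun q => X (Sum.inr (σ q))) 4 := by
    rw [h, show linForm (regularVec K 7) = X (Sum.inl 3) - X (Sum.inr 4) by simp [regularVec], map_sub,
      linSubst_adaptedBasis_inl, linSubst_adaptedBasis_inr]; rfl
  have h8 : linSubst (regularBasis w σ) (X 8) = shear w (fun q => X (Sum.inr (σ q))) 3 := by
    rw [h, show linForm (regularVec K 8) = X (Sum.inr 3) by simp [regularVec], linSubst_adaptedBasis_inr]; rfl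
  have h9 : linSubst (regularBasis w σ) (X 9) = shear w (fun q => X (Sum.inr (σ q))) 4 := by
    rw [h, show linForm (regularVec K 9) = X (Sum.inr 4) by simp [regularVec], linSubst_adaptedBasis_inr]; rfl
  intro ξ η
  simp only [quadric88, quadric89, quadric99, map_add, map_sub, map_mul, h4, h5, h6, h7, h8, h9]
  refine ⟨?_, ?_, ?_⟩ <;> ring

/-- The ideal generated by the symbols of the equations and the first `k` of a family of linear
forms. -/
def symbolIdeal (w : Fin 5 → Fin 5 → K) {n : ℕ} (b : Fin n → (Fin 5 ⊕ Fin 5 → K)) (k : ℕ) :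
    Ideal (MvPolynomial (Fin 5 ⊕ Fin 5) K) :=
  Ideal.span (Set.range (polarH w (symbolOmega K)) ∪
    (fun m => linForm (b m)) '' {m | (m : ℕ) < k})

/-- The ideal of the symbol in quasi-regular coordinates. -/
theorem map_normalIdeal [CharZero K] {w : Fin 5 → Fin 5 → K} (hw : IsSkew w)
    (σ : Equiv.Perm (Fin 5)) (hσ : w (σ 0) (σ 1) ≠ 0) (H : ∀ p, pfH w p = 0) (k : ℕ) :
    (normalIdeal K k).map (linSubst (regularBasis (fun i k => w (σ i) (σ k)) σ) :
        MvPolynomial (Fin 10) K →+* MvPolynomial (Fin 5 ⊕ Fin 5) K) =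
      symbolIdeal w (regularBasis (fun i k => w (σ i) (σ k)) σ) k := by
  set w' : Fin 5 → Fin 5 → K := fun i k => w (σ i) (σ k) with hw'_def
  have hw' : IsSkew w' := hw.comp σ
  have H' : ∀ p, pfH w' p = 0 := pfH_comp_perm_eq_zero σ hw H
  obtain ⟨q1, q2, q3⟩ := linSubst_regularBasis_quadric w' σ
  obtain ⟨e2, e3, e4⟩ := polarH_eq_minor hw' hσ H'
      (fun q => (X (Sum.inl (σ q)) : MvPolynomial (Fin 5 ⊕ Fin 5) K)) (fun q => X (Sum.inr (σ q)))
  set m' := polarH w' (fun i k => symbolOmega K (σ i) (σ k)) with hm'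
  have hm : m' = polarH w' (fun i k => (X (Sum.inl (σ i)) : MvPolynomial (Fin 5 ⊕ Fin 5) K) *
      X (Sum.inr (σ k)) - X (Sum.inl (σ k)) * X (Sum.inr (σ i))) := rfl
  rw [← hm] at e2 e3 e4
  have hperm : ∀ p, m' p = (Equiv.Perm.sign σ : ℤ) • polarH w (symbolOmega K) (σ p) :=
    polarH_comp_perm σ hw isSkew_symbolOmega
  have hperm' : ∀ p, polarH w (symbolOmega K) (σ p) = (Equiv.Perm.sign σ : ℤ) • m' p := by
    intro p
    rw [hperm, smul_smul, Int.units_coe_mul_self, one_smul]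
  have hsmul : ∀ (I : Ideal (MvPolynomial (Fin 5 ⊕ Fin 5) K)) (c : K) f, f ∈ I → c • f ∈ I :=
    fun I c f hf => by rw [smul_eq_C_mul]; exact Ideal.mul_mem_left _ _ hf
  have hsmul' : ∀ (I : Ideal (MvPolynomial (Fin 5 ⊕ Fin 5) K)) (c : K) f, c ≠ 0 → c • f ∈ I →
      f ∈ I := fun I c f hc hf => by
    have := hsmul I c⁻¹ _ hf
    rwa [smul_smul, inv_mul_cancel₀ hc, one_smul] at this
  rw [normalIdeal, Ideal.map_span, Set.image_union]
  apply le_antisymm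
  · rw [Ideal.span_le]
    have hm'_mem : ∀ p, m' p ∈ symbolIdeal w (regularBasis w' σ) k := fun p => by
      have h1 : polarH w (symbolOmega K) (σ p) ∈ symbolIdeal w (regularBasis w' σ) k :=
        Ideal.subset_span (Or.inl ⟨_, rfl⟩)
      rw [hperm]
      exact zsmul_mem h1 _
    rintro _ (⟨q, hq, rfl⟩ | ⟨_, ⟨m, hm, rfl⟩, rfl⟩)
    · simp only [Set.mem_insert_iff, Set.mem_singleton_iff] at hq
      rcases hq with rfl | rfl | rfl
      · refine hsmul' _ _ _ hσ ?_
        have := hm'_mem 4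
        rw [e4] at this
        exact q1 ▸ this
      · refine hsmul' _ _ _ hσ ?_
        have := neg_mem (hm'_mem 3)
        rw [e3, ← smul_neg, neg_sub] at this
        exact q2 ▸ this
      · refine hsmul' _ _ _ hσ ?_
        have := hm'_mem 2
        rw [e2] at this
        exact q3 ▸ this
    · exact Ideal.subset_span (Or.inr ⟨m, hm, (linSubst_X _ _).symm⟩)
  · rw [symbolIdeal, Ideal.span_le]
    set I := Ideal.span ((linSubst (regularBasis w' σ) :
        MvPolynomial (Fin 10) K →+* MvPolynomial (Fin 5 ⊕ Fin 5) K) ''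
          {quadric88 K, quadric89 K, quadric99 K} ∪
      (linSubst (regularBasis w' σ) :
        MvPolynomial (Fin 10) K →+* MvPolynomial (Fin 5 ⊕ Fin 5) K) ''
          (X '' {m : Fin 10 | (m : ℕ) < k})) with hI
    have hq : ∀ q ∈ ({quadric88 K, quadric89 K, quadric99 K} : Set _),
        linSubst (regularBasis w' σ) q ∈ I :=
      fun q hq => Ideal.subset_span (Or.inl ⟨q, hq, rfl⟩)
    have h234 : ∀ p, p ≠ 0 → p ≠ 1 → m' p ∈ I := by
      intro p h0 h1
      have h2 : m' 2 ∈ I := by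
        rw [e2]; exact hsmul _ _ _ (q3 ▸ hq (quadric99 K) (by simp))
      have h3 : m' 3 ∈ I := by
        rw [e3, ← neg_sub, smul_neg]
        exact neg_mem (hsmul _ _ _ (q2 ▸ hq (quadric89 K) (by simp)))
      have h4 : m' 4 ∈ I := by
        rw [e4]; exact hsmul _ _ _ (q1 ▸ hq (quadric88 K) (by simp))
      fin_cases p
      · exact absurd rfl h0
      · exact absurd rfl h1
      · exact h2
      · exact h3
      · exact h4
    have hall : ∀ p, m' p ∈ I := by
      intro p
      have h1 := polarH_mem_span hw' (isSkew_symbolOmega (K := K).comp σ) hσ H' p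
      have h2 : Submodule.span K (Set.range fun p : {p : Fin 5 // p ≠ 0 ∧ p ≠ 1} =>
          polarH w' (fun i k => symbolOmega K (σ i) (σ k)) p) ≤ I.restrictScalars K := by
        rw [Submodule.span_le]
        rintro _ ⟨p, rfl⟩
        exact h234 p p.2.1 p.2.2
      exact h2 h1
    rintro _ (⟨p, rfl⟩ | ⟨m, hm, rfl⟩)
    · obtain ⟨p, rfl⟩ := σ.surjective p
      rw [SetLike.mem_coe, hperm']
      exact zsmul_mem (hall p) _
    · exact Ideal.subset_span (Or.inr ⟨X m, ⟨m, hm, rfl⟩, linSubst_X _ _⟩)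

/-- Families `v_κ` as linear functionals on the polynomial ring; the contractions and the symbol
conditions become the vanishing on the multiples of a polynomial. -/
def familyEquiv (K ι : Type*) [Field K] :
    ((ι →₀ ℕ) → K) ≃ₗ[K] Module.Dual K (MvPolynomial ι K) :=
  (basisMonomials ι K).constr K

theorem familyEquiv_monomial {ι : Type*} (v : (ι →₀ ℕ) → K) (κ : ι →₀ ℕ) :
    familyEquiv K ι v (monomial κ 1) = v κ := by
  have := (basisMonomials ι K).constr_basis K v κ
  rwa [coe_basisMonomials] at this

/-- The equations for the symbol say that a functional vanishes on the multiples of the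
polarized Pfaffians. -/
theorem sum_eval_pderiv_tedH_mul (j : Jet K (Fin 5 ⊕ Fin 5) 2) (p : Fin 5)
    (v : ((Fin 5 ⊕ Fin 5) →₀ ℕ) → K) (ν : (Fin 5 ⊕ Fin 5) →₀ ℕ) :
    ∑ μ ∈ Finset.univ.finsuppAntidiag 2,
        j.eval (pderiv (Sum.inr μ) (tedH K p)) * v (μ + ν) =
      familyEquiv K _ v (monomial ν 1 * polarH (omegaAt j) (symbolOmega K) p) := by
  have hmem : ∀ a b : Fin 5, xy a b ∈ Finset.univ.finsuppAntidiag 2 := fun a b => by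
    simp [Finset.mem_finsuppAntidiag, ← Finsupp.degree_eq_sum, degree_xy]
  let φ : (((Fin 5 ⊕ Fin 5) →₀ ℕ) → K) →ₗ[K] K :=
    ∑ μ ∈ Finset.univ.finsuppAntidiag 2, v (μ + ν) • LinearMap.proj μ
  have hφ : ∀ u, φ u = ∑ μ ∈ Finset.univ.finsuppAntidiag 2, u μ * v (μ + ν) := fun u => by
    simp [φ, mul_comm]
  let Z : Fin 5 → Fin 5 → (((Fin 5 ⊕ Fin 5) →₀ ℕ) → K) := fun i k μ =>
    (if xy i k = μ then 1 else 0) - (if xy k i = μ then 1 else 0)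
  have h1 : ∀ μ, j.eval (pderiv (Sum.inr μ) (tedH K p)) = polarH (omegaAt j) Z p μ := by
    intro μ
    rw [eval_pderiv_tedH]
    fin_cases p <;> rfl
  simp only [h1]
  have h2 : familyEquiv K _ v (monomial ν 1 * polarH (omegaAt j) (symbolOmega K) p) =
      polarH (omegaAt j) (fun i k => familyEquiv K _ v (monomial ν 1 * symbolOmega K i k)) p :=
    map_polarH ((familyEquiv K _ v) ∘ₗ LinearMap.mulLeft K (monomial ν 1)) _ _ p
  have h3 : ∀ a b : Fin 5, ∑ μ ∈ Finset.univ.finsuppAntidiag 2,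
      (if xy a b = μ then (1 : K) else 0) * v (μ + ν) = v (ν + xy a b) := fun a b => by
    rw [Finset.sum_eq_single_of_mem _ (hmem a b)
      fun μ _ h => by rw [if_neg (Ne.symm h), zero_mul], if_pos rfl, one_mul, add_comm]
  have h4 : ∀ a b : Fin 5, monomial ν (1 : K) * symbolOmega K a b =
      monomial (ν + xy a b) 1 - monomial (ν + xy b a) 1 := fun a b => by
    simp only [symbolOmega, X, monomial_mul, mul_one, mul_sub, xy]
  have h5 : (fun i k => φ (Z i k)) =
      fun i k => familyEquiv K _ v (monomial ν 1 * symbolOmega K i k) := by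
    funext i k
    rw [hφ, h4, map_sub, familyEquiv_monomial, familyEquiv_monomial, ← h3, ← h3,
      ← Finset.sum_sub_distrib]
    exact Finset.sum_congr rfl fun μ _ => sub_mul _ _ _
  rw [← hφ, map_polarH, h2, h5]

theorem isHomogeneous_symbolOmega (i k : Fin 5) : (symbolOmega K i k).IsHomogeneous 2 :=
  ((isHomogeneous_X K _).mul (isHomogeneous_X K _)).sub
    ((isHomogeneous_X K _).mul (isHomogeneous_X K _))

theorem polarH_mem {M : Type*} [AddCommGroup M] [Module K M] (V : Submodule K M)
    (w : Fin 5 → Fin 5 → K) {Z : Fin 5 → Fin 5 → M} (hZ : ∀ i k, Z i k ∈ V) (p : Fin 5) :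
    polarH w Z p ∈ V := by
  have : polarH w Z p = V.subtype (polarH w (fun i k => (⟨Z i k, hZ i k⟩ : V)) p) :=
    (map_polarH V.subtype w (fun i k => (⟨Z i k, hZ i k⟩ : V)) p).symm
  rw [this]; exact Subtype.property _

/-- The annihilated parts of the prolongations of the symbol, as dual spaces of homogeneous parts of a
quotient of the polynomial ring. -/
theorem mem_annihilatedPart_symbol_iff {n : ℕ} (j : Jet K (Fin 5 ⊕ Fin 5) 2) (r : ℕ)
    (b : Fin n → (Fin 5 ⊕ Fin 5 → K)) (k : ℕ) (v : ((Fin 5 ⊕ Fin 5) →₀ ℕ) → K) :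
    (v ∈ symbol 2 (tedH K) j r ∧ ∀ m : Fin n, (m : ℕ) < k → ∀ ν,
      ∑ i, b m i * v (ν + Finsupp.single i 1) = 0) ↔
    familyEquiv K _ v ∈ dualPart (2 + r) (symbolIdeal (omegaAt j) b k) := by
  have hb : ∀ m ν, ∑ i, b m i * v (ν + Finsupp.single i 1) =
      familyEquiv K _ v (monomial ν 1 * linForm (b m)) := by
    intro m ν
    simp only [linForm_apply, Finset.mul_sum, map_sum, mul_smul_comm, map_smul, X, monomial_mul,
      mul_one, familyEquiv_monomial, smul_eq_mul]
  rw [mem_dualPart, symbolIdeal, forall_mem_span_apply_eq_zero_iff]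
  simp only [familyEquiv_monomial]
  constructor
  · rintro ⟨⟨h1, h2⟩, h3⟩
    refine ⟨h1, ?_⟩
    rintro _ (⟨p, rfl⟩ | ⟨m, hm, rfl⟩) ν
    · by_cases hν : ν.degree = r
      · rw [← sum_eval_pderiv_tedH_mul]; exact h2 p ν hν
      · refine apply_eq_zero_of_isHomogeneous (n := 2 + r) (d := ν.degree + 2)
          (fun κ hκ => by rw [familyEquiv_monomial]; exact h1 κ hκ) (by omega) ?_
        refine (isHomogeneous_monomial 1 rfl).mul ?_
        exact polarH_mem (homogeneousSubmodule _ K 2) _ isHomogeneous_symbolOmega p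
    · rw [← hb]; exact h3 m hm ν
  · rintro ⟨h1, h2⟩
    refine ⟨⟨h1, fun p ν _ => ?_⟩, fun m hm ν => ?_⟩
    · rw [sum_eval_pderiv_tedH_mul]; exact h2 _ (Or.inl ⟨p, rfl⟩) ν
    · rw [hb]; exact h2 _ (Or.inr ⟨m, hm, rfl⟩) ν

/-- Cartan's test for the TED system; the `k`-th character is the number of monomials of degree
two in the last `10 - k` quasi-regular coordinates that are not leading monomials. -/
theorem cartan_test_ted [CharZero K] (j : Jet K (Fin 5 ⊕ Fin 5) 2) (hj : j ∈ tedDomain K)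
    (H : ∀ p, j.eval (tedH K p) = 0) :
    ∃ b : Module.Basis (Fin (Fintype.card (Fin 5 ⊕ Fin 5))) K (Fin 5 ⊕ Fin 5 → K),
      (∀ k : Fin (Fintype.card (Fin 5 ⊕ Fin 5)),
        Module.finrank K (annihilatedPart (symbol 2 (tedH K) j 0) b k) =
          (standardExponents 2 k).card) ∧
      Module.finrank K (symbol 2 (tedH K) j 1) =
        ∑ k : Fin (Fintype.card (Fin 5 ⊕ Fin 5)), (standardExponents 2 k).card := by
  obtain ⟨i, k, hik⟩ := hj
  have hw := isSkew_omegaAt j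
  have hne : i ≠ k := by rintro rfl; exact hik (hw.diag i)
  obtain ⟨σ, rfl, rfl⟩ := exists_perm_of_ne hne
  have H' : ∀ p, pfH (omegaAt j) p = 0 := fun p => by rw [← eval_tedH, H]
  set b₀ := regularBasis (fun i k => omegaAt j (σ i) (σ k)) σ with hb₀
  have hdim : ∀ n k, k ≤ 9 → Module.finrank K
      ((dualPart n (symbolIdeal (omegaAt j) b₀ k)).comap (familyEquiv K (Fin 5 ⊕ Fin 5) :
        (((Fin 5 ⊕ Fin 5) →₀ ℕ) → K) →ₗ[K] _)) = (standardExponents n k).card := by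
    intro n k hk
    rw [((familyEquiv K (Fin 5 ⊕ Fin 5)).ofSubmodule' _).finrank_eq,
      ← map_normalIdeal hw σ hik H', finrank_dualPart_map, finrank_dualPart_normalIdeal n hk]
  refine ⟨b₀, fun k => ?_, ?_⟩
  · have e : annihilatedPart (symbol 2 (tedH K) j 0) b₀ k =
        (dualPart 2 (symbolIdeal (omegaAt j) b₀ k)).comap (familyEquiv K (Fin 5 ⊕ Fin 5) :
          (((Fin 5 ⊕ Fin 5) →₀ ℕ) → K) →ₗ[K] _) := by
      ext v
      exact mem_annihilatedPart_symbol_iff j 0 b₀ k v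
    rw [e, hdim 2 k (Nat.le_of_lt_succ k.2)]
  · have e : symbol 2 (tedH K) j 1 =
        (dualPart 3 (symbolIdeal (omegaAt j) b₀ 0)).comap (familyEquiv K (Fin 5 ⊕ Fin 5) :
          (((Fin 5 ⊕ Fin 5) →₀ ℕ) → K) →ₗ[K] _) := by
      ext v
      refine Iff.trans ?_ (mem_annihilatedPart_symbol_iff j 1 b₀ 0 v)
      simp
    rw [e, hdim 3 0 (by omega)]
    exact card_standardExponents_three

end CartanTest

end

theorem theorem3 (𝕜 : Type*) [RCLike 𝕜] :
    IsInInvolution 2 (tedH 𝕜) (tedDomain 𝕜) ∧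
    (∀ (j : Jet 𝕜 (Fin 5 ⊕ Fin 5) 2) (i k : Fin 5), j.eval (tedOmega 𝕜 i k) ≠ 0 →
      ((∀ p, j.eval (tedH 𝕜 p) = 0) ↔ ∀ p, p ≠ i → p ≠ k → j.eval (tedH 𝕜 p) = 0) ∧
      LinearIndependent 𝕜
        (fun p : {p : Fin 5 // p ≠ i ∧ p ≠ k} => j.gradient (tedH 𝕜 p))) ∧
    (∀ j ∈ tedDomain 𝕜, (∀ p, j.eval (tedH 𝕜 p) = 0) →
      Module.finrank 𝕜
        (Submodule.span 𝕜 (Set.range (fun p : Fin 5 => j.gradient (tedH 𝕜 p)))) = 3) := by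
  refine ⟨⟨?_, isOpen_tedDomain, ⟨3, isFibredSubmanifold_ted⟩, exists_prolongation_extension,
    ⟨fun k => (standardExponents 2 k).card, cartan_test_ted⟩⟩, fun j i k h => ⟨?_, ?_⟩, ?_⟩
  · intro p μ hμ
    exact MvPolynomial.mem_supported.1 (tedH_mem_orderLE (𝕜 := 𝕜) p) hμ μ rfl
  · simp only [eval_tedH]
    exact pfH_eq_zero_iff (isSkew_omegaAt j) h
  · exact linearIndependent_gradient_tedH h
  · rintro j ⟨i, k, h⟩ H
    exact finrank_span_gradient_tedH h H
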